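/- Let $\mathsf{k}$ and $\mathfrak{h}$ be complex Hilbert spaces (inner products linear in the second variable) and let $\mathcal{F}$ be the symmetric Fock space over $L^2(\mathbb{R}_+;\mathsf{k})$, with normalised exponential vectors $\varpi(f)=e^{-\|f\|^2/2}\big((n!)^{-1/2}f^{\otimes n}\big)_{n\ge 0}$. For $J\subseteq\mathbb{R}_+$ an interval let $\mathcal{F}_J$ be the symmetric Fock space over $L^2(J;\mathsf{k})$, so that $\mathcal{F}=\mathcal{F}_{[0,t[}\otimes\mathcal{F}_{[t,\infty[}$ via $\varpi(f)\mapsto\varpi(f|_{[0,t[})\otimes\varpi(f|_{[t,\infty[})$; let $\sigma_r$ be the ampliation to $B(\mathfrak{h}\otimes\mathcal{F})$ of the CCR flow, that is, $\sigma_r(T)$ is $T$ carried to $\mathfrak{h}\otimes\mathcal{F}_{[r,\infty[}$ by the second quantisation of the right shift by $r$, tensored with the identity of $\mathcal{F}_{[0,r[}$. A left contraction operator QS cocycle on $\mathfrak{h}$ is a family $(X_t)_{t\ge 0}$ of contractions on $\mathfrak{h}\otimes\mathcal{F}$ with $X_t\in B(\mathfrak{h}\otimes\mathcal{F}_{[0,t[})\otimes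 I_{\mathcal{F}_{[t,\infty[}}$, $X_0=I$ and $X_{r+t}=X_r\,\sigma_r(X_t)$ for all $r,t\ge 0$. Its associated semigroups are $X^{x,y}_t:=E(x_{[0,t[})^*X_tE(y_{[0,t[})\in B(\mathfrak{h})$ $(x,y\in\mathsf{k},\ t\ge0)$, where $E(f)u=u\otimes\varpi(f)$ and $x_{[0,t[}$ is the function equal to $x$ on $[0,t[$ and $0$ elsewhere. A semigroup on $\mathfrak{h}$ is a family $(P_t)_{t\ge0}$ in $B(\mathfrak{h})$ with $P_0=I$ and $P_{s+t}=P_sP_t$ (no continuity in $t$ is assumed). For $\mathbf{x}\in\mathsf{k}^n$ and $t\ge 0$ put $\varpi^{\mathbf{x}}_t:=\big[e^{-t\chi(x^i,x^j)}\big]_{i,j=1}^n\in M_n(\mathbb{C})$, where $\chi(u,v)=\tfrac12(\|u\|^2+\|v\|^2)-\langle u,v\rangle$. Let $|\mathfrak{h}\rangle=B(\mathbb{C};\mathfrak{h})$, and give $M_n(|\mathfrak{h}\rangle)=B(\mathbb{C}^n;\mathfrak{h}^n)$ the operator norm. The symbol $\circ$ denotes the Schur (entrywise) product, and $M_n(\mathbb{C})_{++}$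 the set of positive definite $n\times n$ matrices. **Theorem.** Let $\mathsf{T}$ be a total subset of $\mathsf{k}$ containing $0$ and let $S=\{S^{x,y}:x,y\in\mathsf{T}\}$ be a family of semigroups on $\mathfrak{h}$. Then there is a left contraction operator QS cocycle on $\mathfrak{h}$ whose associated semigroups include $S$ (that is, $X^{x,y}_t=S^{x,y}_t$ for all $x,y\in\mathsf{T}$, $t\ge0$) if and only if, for all $n\ge 1$, $\lambda,\mu\in M_n(\mathbb{C})_{++}$, $\mathbf{x}\in\mathsf{T}^n$, $t\ge 0$ and $A\in M_n(|\mathfrak{h}\rangle)$, $$\Big\|(\lambda\circ\varpi^{\mathbf{x}}_t)^{-1/2}\Big(S^{\mathbf{x}}_t\circ(\lambda^{1/2}A\mu^{1/2})\Big)(\mu\circ\varpi^{\mathbf{x}}_t)^{-1/2}\Big\|\le\|A\|,$$ where $S^{\mathbf{x}}_t\circ B:=[S^{x^i,x^j}_tB^i_j]_{i,j=1}^n$ and scalar matrices act on $M_n(|\mathfrak{h}\rangle)$ by matrix multiplication. -/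

import Mathlib

open MeasureTheory Set
open scoped TensorProduct NNReal MatrixOrder ComplexOrder

noncomputable section

namespace QSCocycle

universe u v

/-! ### Hilbert space tensor products -/

/-- The Hilbert space tensor product: the completion of the algebraic tensor product for the
inner product `⟪x ⊗ y, x' ⊗ y'⟫ = ⟪x, x'⟫ ⟪y, y'⟫`. -/
def HTensor (E : Type u) (F : Type v)
    [NormedAddCommGroup E] [InnerProductSpace ℂ E]
    [NormedAddCommGroup F] [InnerProductSpace ℂ F] : Type (max u v) :=
  UniformSpace.Completion (E ⊗[ℂ] F)

section HTensor

variable {E : Type u} {F : Type v}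
  [NormedAddCommGroup E] [InnerProductSpace ℂ E]
  [NormedAddCommGroup F] [InnerProductSpace ℂ F]

instance : NormedAddCommGroup (HTensor E F) :=
  inferInstanceAs (NormedAddCommGroup (UniformSpace.Completion (E ⊗[ℂ] F)))

instance : InnerProductSpace ℂ (HTensor E F) :=
  inferInstanceAs (InnerProductSpace ℂ (UniformSpace.Completion (E ⊗[ℂ] F)))

instance : CompleteSpace (HTensor E F) :=
  inferInstanceAs (CompleteSpace (UniformSpace.Completion (E ⊗[ℂ] F)))

/-- The isometric embedding of the algebraic tensor product. -/
def HTensor.ofAlg : E ⊗[ℂ] F →ₗᵢ[ℂ] HTensor E F := UniformSpace.Completion.toComplₗᵢ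

theorem HTensor.denseRange_ofAlg : DenseRange (HTensor.ofAlg (E := E) (F := F)) :=
  UniformSpace.Completion.denseRange_coe

/-- The simple tensor `x ⊗ y`, as a bounded bilinear map. -/
def htmulL : E →L[ℂ] F →L[ℂ] HTensor E F :=
  (ContinuousLinearMap.compL ℂ F (E ⊗[ℂ] F) (HTensor E F)
    HTensor.ofAlg.toContinuousLinearMap).comp (TensorProduct.mkL ℂ E F)

/-- The simple tensor `x ⊗ y`. -/
def htmul (x : E) (y : F) : HTensor E F := htmulL x y

/-- The ampliation `T ⊗ I_F` of a bounded operator `T` on `E`. -/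
def ampl (F : Type v) [NormedAddCommGroup F] [InnerProductSpace ℂ F]
    (T : E →L[ℂ] E) : HTensor E F →L[ℂ] HTensor E F :=
  (T.rTensor F).completion

theorem htmul_eq_ofAlg (x : E) (y : F) : htmul x y = HTensor.ofAlg (x ⊗ₜ[ℂ] y) := rfl

theorem ampl_htmul (T : E →L[ℂ] E) (x : E) (y : F) :
    ampl F T (htmul x y) = htmul (T x) y :=
  ContinuousLinearMap.completion_apply_coe (T.rTensor F) (x ⊗ₜ[ℂ] y)

theorem inner_htmul (x x' : E) (y y' : F) :
    inner ℂ (htmul x y) (htmul x' y') = inner ℂ x x' * inner ℂ y y' := by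
  rw [htmul_eq_ofAlg, htmul_eq_ofAlg, LinearIsometry.inner_map_map, TensorProduct.inner_tmul]

theorem dense_span_id :
    (Submodule.span ℂ (range fun x : E => x)).topologicalClosure = ⊤ := by
  rw [show range (fun x : E => x) = univ from range_id, Submodule.span_univ]
  exact top_unique (Submodule.le_topologicalClosure _)

/-- Simple tensors of total families are total. -/
theorem dense_span_htmul {ι κ : Type*} {a : ι → E} {b : κ → F}
    (ha : (Submodule.span ℂ (range a)).topologicalClosure = ⊤)
    (hb : (Submodule.span ℂ (range b)).topologicalClosure = ⊤) :
    (Submodule.span ℂ (range fun p : ι × κ => htmul (a p.1) (b p.2))).topologicalClosure = ⊤ := by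
  set W := (Submodule.span ℂ
    (range fun p : ι × κ => htmul (a p.1) (b p.2))).topologicalClosure with hW
  have hWc : IsClosed (W : Set (HTensor E F)) := Submodule.isClosed_topologicalClosure _
  have h0 : ∀ i j, htmul (a i) (b j) ∈ W := fun i j =>
    Submodule.le_topologicalClosure _ (Submodule.subset_span ⟨(i, j), rfl⟩)
  have h1 : ∀ i y, htmul (a i) y ∈ W := by
    intro i
    have : (Submodule.span ℂ (range b)).topologicalClosure ≤
        W.comap (htmulL (F := F) (a i)).toLinearMap := by
      refine Submodule.topologicalClosure_minimal _ ?_ ?_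
      · rw [Submodule.span_le]
        rintro _ ⟨j, rfl⟩
        exact h0 i j
      · exact hWc.preimage (htmulL (F := F) (a i)).continuous
    intro y
    exact this (hb ▸ Submodule.mem_top)
  have h2 : ∀ x y, htmul x y ∈ W := by
    intro x y
    have : (Submodule.span ℂ (range a)).topologicalClosure ≤
        W.comap ((htmulL (E := E) (F := F)).flip y).toLinearMap := by
      refine Submodule.topologicalClosure_minimal _ ?_ ?_
      · rw [Submodule.span_le]
        rintro _ ⟨i, rfl⟩
        exact h1 i y
      · exact hWc.preimage ((htmulL (E := E) (F := F)).flip y).continuous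
    exact this (ha ▸ Submodule.mem_top)
  rw [eq_top_iff]
  intro z _
  refine HTensor.denseRange_ofAlg.induction_on z hWc ?_
  intro z
  induction z using TensorProduct.induction_on with
  | zero => rw [LinearIsometry.map_zero]; exact W.zero_mem
  | tmul x y => exact h2 x y
  | add x y hx hy => rw [LinearIsometry.map_add]; exact W.add_mem hx hy

end HTensor

/-! ### Symmetric Fock space -/

/-- A bundled complex Hilbert space, used only to define tensor powers by recursion. -/
structure HilbertObj : Type (u + 1) where
  carrier : Type u
  [grp : NormedAddCommGroup carrier]
  [ips : InnerProductSpace ℂ carrier]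
  [cpl : CompleteSpace carrier]

attribute [instance] HilbertObj.grp HilbertObj.ips HilbertObj.cpl

section Fock

variable (H : Type u) [NormedAddCommGroup H] [InnerProductSpace ℂ H]

/-- `H^{⊗ 0} = ℂ` and `H^{⊗ (n + 1)} = H ⊗ H^{⊗ n}`. -/
def tensorPowObj : ℕ → HilbertObj.{u}
  | 0 => ⟨EuclideanSpace ℂ PUnit.{u + 1}⟩
  | n + 1 => ⟨HTensor H (tensorPowObj n).carrier⟩

/-- The `n`-th Hilbert space tensor power of `H`. -/
abbrev TensorPow (n : ℕ) : Type u := (tensorPowObj H n).carrier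

variable {H}

/-- The vector `f^{⊗ n}`. -/
def vecPow (f : H) : (n : ℕ) → TensorPow H n
  | 0 => EuclideanSpace.single (𝕜 := ℂ) PUnit.unit (1 : ℂ)
  | n + 1 => (htmul f (vecPow f n) : HTensor H (TensorPow H n))

theorem inner_vecPow (f g : H) (n : ℕ) :
    inner ℂ (vecPow f n) (vecPow g n) = (inner ℂ f g) ^ n := by
  induction n with
  | zero =>
    change inner ℂ (EuclideanSpace.single (𝕜 := ℂ) PUnit.unit (1 : ℂ))
      (EuclideanSpace.single (𝕜 := ℂ) PUnit.unit (1 : ℂ)) = _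
    simp
  | succ n ih =>
    change inner ℂ (htmul f (vecPow f n) : HTensor H (TensorPow H n))
      (htmul g (vecPow g n) : HTensor H (TensorPow H n)) = _
    rw [inner_htmul, ih, pow_succ']

theorem vecPow_smul (c : ℂ) (f : H) (n : ℕ) : vecPow (c • f) n = c ^ n • vecPow f n := by
  induction n with
  | zero => rw [pow_zero, one_smul]; rfl
  | succ n ih =>
    change (htmulL (c • f) (vecPow (c • f) n) : HTensor H (TensorPow H n)) =
      c ^ (n + 1) • (htmulL f (vecPow f n) : HTensor H (TensorPow H n))
    rw [ih]
    simp [smul_smul, pow_succ]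

theorem norm_vecPow (f : H) (n : ℕ) : ‖vecPow f n‖ = ‖f‖ ^ n := by
  have h := inner_vecPow f f n
  rw [inner_self_eq_norm_sq_to_K, inner_self_eq_norm_sq_to_K] at h
  have h' : ‖vecPow f n‖ ^ 2 = (‖f‖ ^ n) ^ 2 := by
    rw [← pow_mul, mul_comm, pow_mul]
    exact_mod_cast h
  exact (pow_left_inj₀ (norm_nonneg _) (by positivity) two_ne_zero).1 h'

variable (H) in
/-- The `n`-particle space: the closed subspace of `H^{⊗ n}` spanned by the vectors `f^{⊗ n}`
(by polarisation, this is the subspace of symmetric tensors). -/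
def SymPow (n : ℕ) : Submodule ℂ (TensorPow H n) :=
  (Submodule.span ℂ (range fun f : H => vecPow f n)).topologicalClosure

instance (n : ℕ) : CompleteSpace (SymPow H n) :=
  (Submodule.isClosed_topologicalClosure _).completeSpace_coe

/-- `f^{⊗ n}` as a symmetric tensor. -/
def symVec (f : H) (n : ℕ) : SymPow H n :=
  ⟨vecPow f n, Submodule.le_topologicalClosure _ (Submodule.subset_span ⟨f, rfl⟩)⟩

variable (H) in
/-- The symmetric Fock space over `H`: the Hilbert space direct sum of the `n`-particle spaces. -/
def Fock : Type u := lp (fun n : ℕ => SymPow H n) 2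

instance : NormedAddCommGroup (Fock H) :=
  inferInstanceAs (NormedAddCommGroup (lp (fun n : ℕ => SymPow H n) 2))

instance : InnerProductSpace ℂ (Fock H) :=
  inferInstanceAs (InnerProductSpace ℂ (lp (fun n : ℕ => SymPow H n) 2))

instance : CompleteSpace (Fock H) :=
  inferInstanceAs (CompleteSpace (lp (fun n : ℕ => SymPow H n) 2))

/-- The `n`-particle component of a Fock space vector. -/
def Fock.component (ξ : Fock H) (n : ℕ) : SymPow H n := ξ.1 n

theorem Fock.hasSum_inner (ξ η : Fock H) :
    HasSum (fun n => inner ℂ (ξ.component n) (η.component n)) (inner ℂ ξ η) :=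
  lp.hasSum_inner (𝕜 := ℂ) (G := fun n : ℕ => SymPow H n) ξ η

/-- The sequence `e^{-‖f‖²/2} ((n!)^{-1/2} f^{⊗ n})_n`. -/
def expSeq (f : H) (n : ℕ) : SymPow H n :=
  ((Real.exp (-(‖f‖ ^ 2 / 2)) * (Real.sqrt n.factorial)⁻¹ : ℝ) : ℂ) • symVec f n

theorem norm_expSeq_sq (f : H) (n : ℕ) :
    ‖expSeq f n‖ ^ 2 = Real.exp (-(‖f‖ ^ 2)) * ((‖f‖ ^ 2) ^ n / n.factorial) := by
  have hs : ‖symVec f n‖ = ‖f‖ ^ n := norm_vecPow f n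
  have hf : (Real.sqrt n.factorial) ^ 2 = n.factorial := Real.sq_sqrt (by positivity)
  have he : Real.exp (-(‖f‖ ^ 2 / 2)) ^ 2 = Real.exp (-(‖f‖ ^ 2)) := by
    rw [← Real.exp_nat_mul]; congr 1; push_cast; ring
  rw [expSeq, norm_smul, hs, Complex.norm_real, Real.norm_of_nonneg (by positivity), mul_pow,
    mul_pow, inv_pow, hf, he]
  ring

theorem memℓp_expSeq (f : H) : Memℓp (expSeq f) 2 := by
  refine memℓp_gen ?_
  have : Summable fun n : ℕ =>
      Real.exp (-(‖f‖ ^ 2)) * ((‖f‖ ^ 2) ^ n / n.factorial) :=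
    (Real.summable_pow_div_factorial (‖f‖ ^ 2)).mul_left _
  refine this.congr fun n => ?_
  rw [← norm_expSeq_sq]
  simp

/-- The normalised exponential vector (coherent vector) of `f`. -/
def expVec (f : H) : Fock H := ⟨expSeq f, memℓp_expSeq f⟩

/-- `χ(f, g) = (‖f‖² + ‖g‖²) / 2 - ⟪f, g⟫`. -/
def chi (f g : H) : ℂ := ((‖f‖ ^ 2 + ‖g‖ ^ 2) / 2 : ℝ) - inner ℂ f g

theorem inner_expVec (f g : H) :
    inner ℂ (expVec f) (expVec g) = Complex.exp (-chi f g) := by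
  rw [← (Fock.hasSum_inner (expVec f) (expVec g)).tsum_eq]
  have h : ∀ n : ℕ, inner ℂ ((expVec f).component n) ((expVec g).component n) =
      Complex.exp (-((‖f‖ ^ 2 + ‖g‖ ^ 2) / 2 : ℝ)) * ((inner ℂ f g) ^ n / n.factorial) := by
    intro n
    have hs : inner ℂ (symVec f n) (symVec g n) = (inner ℂ f g) ^ n := inner_vecPow f g n
    have hf : ((Real.sqrt n.factorial : ℝ) : ℂ) * (Real.sqrt n.factorial : ℝ) = n.factorial := by
      rw [← Complex.ofReal_mul, Real.mul_self_sqrt (by positivity)]; simp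
    have h0 : ((Real.sqrt n.factorial : ℝ) : ℂ) ≠ 0 := by
      rw [Complex.ofReal_ne_zero]; positivity
    have he : Complex.exp (-((‖f‖ ^ 2 + ‖g‖ ^ 2) / 2 : ℝ)) =
        Complex.exp (-(‖f‖ ^ 2 / 2 : ℝ)) * Complex.exp (-(‖g‖ ^ 2 / 2 : ℝ)) := by
      rw [← Complex.exp_add]; congr 1; push_cast; ring
    change inner ℂ (expSeq f n) (expSeq g n) = _
    rw [expSeq, expSeq, inner_smul_left, inner_smul_right, hs, Complex.conj_ofReal, he, ← hf]
    push_cast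
    field_simp
  simp_rw [h]
  rw [tsum_mul_left]
  have h1 : Complex.exp (inner ℂ f g) = ∑' n : ℕ, (inner ℂ f g) ^ n / (n.factorial : ℂ) := by
    rw [Complex.exp_eq_exp_ℂ, NormedSpace.exp_eq_tsum_div]
  rw [← h1, ← Complex.exp_add, chi]
  congr 1
  push_cast
  ring

/-- The exponential vectors are total in Fock space. -/
theorem dense_span_expVec :
    (Submodule.span ℂ (range (expVec (H := H)))).topologicalClosure = ⊤ := by
  rw [Submodule.topologicalClosure_eq_top_iff, Submodule.eq_bot_iff]
  intro ξ hξ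
  have hξ' : ∀ f : H, inner ℂ ξ (expVec f) = 0 := fun f =>
    Submodule.inner_left_of_mem_orthogonal (Submodule.subset_span (mem_range_self f)) hξ
  have key : ∀ (f : H) (n : ℕ), inner ℂ (ξ.component n) (symVec f n) = 0 := by
    intro f
    set b : ℕ → ℂ := fun n => ((Real.sqrt n.factorial)⁻¹ : ℝ) * inner ℂ (ξ.component n) (symVec f n)
      with hb
    have hsum : ∀ z : ℂ, HasSum (fun n => z ^ n * b n) 0 := by
      intro z
      have h1 := Fock.hasSum_inner ξ (expVec (z • f))
      rw [hξ' (z • f)] at h1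
      have h2 := h1.mul_left (Complex.exp ((‖z • f‖ ^ 2 / 2 : ℝ)))
      rw [mul_zero] at h2
      have he : (fun n => z ^ n * b n) = fun n => Complex.exp ((‖z • f‖ ^ 2 / 2 : ℝ)) *
          inner ℂ (ξ.component n) (expSeq (z • f) n) := by
        funext n
        have hs : symVec (z • f) n = z ^ n • symVec f n := Subtype.ext (vecPow_smul z f n)
        have h3 : Complex.exp ((‖z • f‖ ^ 2 / 2 : ℝ)) *
            Complex.exp ((-(‖z • f‖ ^ 2 / 2) : ℝ)) = 1 := by
          rw [← Complex.exp_add]; simp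
        rw [expSeq, inner_smul_right, hs, inner_smul_right, Complex.ofReal_mul, Complex.ofReal_exp,
          hb]
        linear_combination (-(z ^ n * ((Real.sqrt n.factorial)⁻¹ : ℝ) *
          inner ℂ (ξ.component n) (symVec f n))) * h3
      rw [he]
      exact h2
    have hps : HasFPowerSeriesAt (0 : ℂ → ℂ) (FormalMultilinearSeries.ofScalars ℂ b) 0 := by
      rw [hasFPowerSeriesAt_iff]
      refine Filter.Eventually.of_forall fun z => ?_
      simpa using hsum z
    intro n
    have hn : b n = 0 := by
      rw [← FormalMultilinearSeries.coeff_ofScalars (𝕜 := ℂ) (p := b) (n := n), hps.eq_zero]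
      rfl
    have h0 : (((Real.sqrt n.factorial)⁻¹ : ℝ) : ℂ) ≠ 0 := by
      rw [Complex.ofReal_ne_zero]; positivity
    exact (mul_eq_zero.1 hn).resolve_left h0
  refine Subtype.ext (funext fun n => ?_)
  have hle : (SymPow H n) ≤ (LinearMap.ker (innerSL ℂ (ξ.component n : TensorPow H n)).toLinearMap) := by
    refine Submodule.topologicalClosure_minimal _ ?_ ?_
    · rw [Submodule.span_le]
      rintro _ ⟨f, rfl⟩
      exact key f n
    · exact (innerSL ℂ (ξ.component n : TensorPow H n)).isClosed_ker
  have h0 : inner ℂ (ξ.component n) (ξ.component n) = 0 := hle (ξ.component n).2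
  exact inner_self_eq_zero.1 h0

end Fock

/-! ### Exponential property of Fock space -/

section Factor

variable (h : Type v) [NormedAddCommGroup h] [InnerProductSpace ℂ h]
  {H H₁ H₂ : Type u}
  [NormedAddCommGroup H] [InnerProductSpace ℂ H]
  [NormedAddCommGroup H₁] [InnerProductSpace ℂ H₁]
  [NormedAddCommGroup H₂] [InnerProductSpace ℂ H₂]

/-- For isometries `i₁ : H₁ → H` and `i₂ : H₂ → H` with orthogonal ranges spanning `H`, the
identification of `h ⊗ Fock H₁ ⊗ Fock H₂` with `h ⊗ Fock H`, which is the unique bounded operator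
that sends each `(u ⊗ w(f)) ⊗ w(g)` to `u ⊗ w(i₁ f + i₂ g)`. -/
def factor (i₁ : H₁ →ₗᵢ[ℂ] H) (i₂ : H₂ →ₗᵢ[ℂ] H) :
    HTensor (HTensor h (Fock H₁)) (Fock H₂) →L[ℂ] HTensor h (Fock H) :=
  (Finsupp.linearCombination ℂ fun p : (h × H₁) × H₂ =>
      (htmul p.1.1 (expVec (i₁ p.1.2 + i₂ p.2)) : HTensor h (Fock H))).extendOfNorm
    (Finsupp.linearCombination ℂ fun p : (h × H₁) × H₂ =>
      (htmul (htmul p.1.1 (expVec p.1.2)) (expVec p.2) :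
        HTensor (HTensor h (Fock H₁)) (Fock H₂)))

theorem norm_linearCombination_eq {ι E F : Type*}
    [NormedAddCommGroup E] [InnerProductSpace ℂ E] [NormedAddCommGroup F] [InnerProductSpace ℂ F]
    {a : ι → E} {b : ι → F} (hab : ∀ i j, inner ℂ (a i) (a j) = inner ℂ (b i) (b j))
    (c : ι →₀ ℂ) :
    ‖Finsupp.linearCombination ℂ a c‖ = ‖Finsupp.linearCombination ℂ b c‖ := by
  have : inner ℂ (Finsupp.linearCombination ℂ a c) (Finsupp.linearCombination ℂ a c) =
      inner ℂ (Finsupp.linearCombination ℂ b c) (Finsupp.linearCombination ℂ b c) := by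
    simp only [Finsupp.linearCombination_apply, Finsupp.sum, sum_inner, inner_sum,
      inner_smul_left, inner_smul_right, hab]
  rw [@norm_eq_sqrt_re_inner ℂ, @norm_eq_sqrt_re_inner ℂ, this]

variable {h}

theorem dense_span_factor_source :
    (Submodule.span ℂ (range fun p : (h × H₁) × H₂ =>
      (htmul (htmul p.1.1 (expVec p.1.2)) (expVec p.2) :
        HTensor (HTensor h (Fock H₁)) (Fock H₂)))).topologicalClosure = ⊤ := by
  have := dense_span_htmul (dense_span_htmul (dense_span_id (E := h))
    (dense_span_expVec (H := H₁))) (dense_span_expVec (H := H₂))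
  exact this

theorem extendOfNorm_eq_of_inner {ι E F : Type*}
    [NormedAddCommGroup E] [InnerProductSpace ℂ E]
    [NormedAddCommGroup F] [InnerProductSpace ℂ F] [CompleteSpace F]
    {a : ι → E} {b : ι → F} (ha : (Submodule.span ℂ (range a)).topologicalClosure = ⊤)
    (hab : ∀ i j, inner ℂ (b i) (b j) = inner ℂ (a i) (a j)) (i : ι) :
    (Finsupp.linearCombination ℂ b).extendOfNorm (Finsupp.linearCombination ℂ a) (a i) = b i := by
  have hdense : DenseRange (Finsupp.linearCombination ℂ a) := by
    rw [← Finsupp.range_linearCombination, ← Submodule.dense_iff_topologicalClosure_eq_top] at ha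
    exact ha
  have key := LinearMap.extendOfNorm_eq (f := Finsupp.linearCombination ℂ b) hdense
    ⟨1, fun c => by rw [one_mul]; exact (norm_linearCombination_eq hab c).le⟩ (Finsupp.single i 1)
  rwa [Finsupp.linearCombination_single, Finsupp.linearCombination_single, one_smul,
    one_smul] at key

theorem chi_add_of_orthogonal (i₁ : H₁ →ₗᵢ[ℂ] H) (i₂ : H₂ →ₗᵢ[ℂ] H)
    (hi : ∀ f g, inner ℂ (i₁ f) (i₂ g) = 0) (f f' : H₁) (g g' : H₂) :
    chi (i₁ f + i₂ g) (i₁ f' + i₂ g') = chi f f' + chi g g' := by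
  have hi' : ∀ f g, inner ℂ (i₂ g) (i₁ f) = 0 := fun f g => by
    rw [← inner_conj_symm, hi, map_zero]
  have hn : ∀ f g, ‖i₁ f + i₂ g‖ ^ 2 = ‖f‖ ^ 2 + ‖g‖ ^ 2 := fun f g => by
    rw [sq, norm_add_sq_eq_norm_sq_add_norm_sq_of_inner_eq_zero _ _ (hi f g), i₁.norm_map,
      i₂.norm_map, sq, sq]
  rw [chi, chi, chi, hn, hn, inner_add_left, inner_add_right, inner_add_right, hi, hi',
    i₁.inner_map_map, i₂.inner_map_map]
  push_cast
  ring

theorem factor_apply (i₁ : H₁ →ₗᵢ[ℂ] H) (i₂ : H₂ →ₗᵢ[ℂ] H)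
    (hi : ∀ f g, inner ℂ (i₁ f) (i₂ g) = 0) (u : h) (f : H₁) (g : H₂) :
    factor h i₁ i₂ (htmul (htmul u (expVec f)) (expVec g)) =
      htmul u (expVec (i₁ f + i₂ g)) :=
  extendOfNorm_eq_of_inner dense_span_factor_source
    (fun p q => by
      rw [inner_htmul, inner_htmul, inner_htmul, inner_expVec, inner_expVec, inner_expVec,
        mul_assoc, ← Complex.exp_add, chi_add_of_orthogonal i₁ i₂ hi, neg_add]) ((u, f), g)

end Factor

/-! ### Quantum stochastic operator cocycles -/

section Cocycle

variable (k : Type u) [NormedAddCommGroup k] [InnerProductSpace ℂ k]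

/-- `L²(J; k)`, identified with the subspace of `L²(ℝ; k)` of functions vanishing off `J`. -/
def L2 (J : Set ℝ) : Submodule ℂ (Lp k 2 (volume : Measure ℝ)) where
  carrier := {f | ∀ᵐ s, s ∉ J → f s = 0}
  zero_mem' := by
    filter_upwards [Lp.coeFn_zero k 2 (volume : Measure ℝ)] with s hs _ using hs
  add_mem' {f g} hf hg := by
    filter_upwards [hf, hg, Lp.coeFn_add f g] with s h1 h2 h3 hs
    rw [h3, Pi.add_apply, h1 hs, h2 hs, add_zero]
  smul_mem' c f hf := by
    filter_upwards [hf, Lp.coeFn_smul c f] with s h1 h2 hs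
    rw [h2, Pi.smul_apply, h1 hs, smul_zero]

/-- `L²(ℝ₊; k)`. -/
abbrev L2Plus : Submodule ℂ (Lp k 2 (volume : Measure ℝ)) := L2 k (Ici 0)

variable {k}

/-- The inclusion `L²(J; k) ⊆ L²(K; k)` for `J ⊆ K`. -/
def L2.incl {J K : Set ℝ} (hJK : J ⊆ K) : L2 k J →ₗᵢ[ℂ] L2 k K where
  toLinearMap := Submodule.inclusion fun f hf => by
    filter_upwards [show ∀ᵐ s, s ∉ J → f s = 0 from hf] with s hs hsK
    exact hs fun h => hsK (hJK h)
  norm_map' _ := rfl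

variable (k)

/-- The inclusion `L²([0, t[; k) ⊆ L²(ℝ₊; k)`. -/
def past (t : ℝ≥0) : L2 k (Ico 0 (t : ℝ)) →ₗᵢ[ℂ] L2Plus k := L2.incl Ico_subset_Ici_self

/-- The inclusion `L²([t, ∞[; k) ⊆ L²(ℝ₊; k)`. -/
def future (t : ℝ≥0) : L2 k (Ici (t : ℝ)) →ₗᵢ[ℂ] L2Plus k := L2.incl (Ici_subset_Ici.2 t.2)

/-- The right shift `s_r` on `L²(ℝ₊; k)`: `(s_r f)(s) = f(s - r)` for `s ≥ r` and
`(s_r f)(s) = 0` for `s < r`. -/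
def rightShift (r : ℝ≥0) : L2Plus k →ₗᵢ[ℂ] L2Plus k where
  toFun f := ⟨Lp.compMeasurePreserving (fun s : ℝ => s - r)
      (measurePreserving_sub_right volume (r : ℝ)) f.1, by
    have h1 := Lp.coeFn_compMeasurePreserving f.1 (measurePreserving_sub_right volume (r : ℝ))
    have h2 := (measurePreserving_sub_right volume (r : ℝ)).quasiMeasurePreserving.ae f.2
    filter_upwards [h1, h2] with s hs1 hs2 hs
    rw [hs1]
    refine hs2 fun h => hs ?_
    have h' : (0 : ℝ) ≤ s - r := h
    exact le_trans r.2 (sub_nonneg.1 h')⟩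
  map_add' f g := Subtype.ext (map_add _ _ _)
  map_smul' c f := Subtype.ext
    (map_smul (Lp.compMeasurePreservingₗ ℂ (E := k) (p := 2) (fun s : ℝ => s - r)
      (measurePreserving_sub_right volume (r : ℝ))) c f.1)
  norm_map' f := Lp.norm_compMeasurePreserving f.1 _

variable {k}

/-- `x_{[0,t[}`: the function on `ℝ₊` equal to `x` on `[0, t[` and to `0` elsewhere. -/
def constOn (x : k) (t : ℝ≥0) : L2Plus k :=
  ⟨indicatorConstLp 2 (measurableSet_Ico (a := (0 : ℝ)) (b := t)) (by simp) x, by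
    filter_upwards [indicatorConstLp_coeFn (p := 2)
      (hs := measurableSet_Ico (a := (0 : ℝ)) (b := t)) (hμs := by simp) (c := x)] with s hs hs0
    rw [hs, indicator_of_notMem]
    exact fun h => hs0 h.1⟩

theorem L2.inner_eq_zero {J K : Set ℝ} (hJK : Disjoint J K) {f g : Lp k 2 (volume : Measure ℝ)}
    (hf : f ∈ L2 k J) (hg : g ∈ L2 k K) : inner ℂ f g = 0 := by
  rw [MeasureTheory.L2.inner_def]
  refine integral_eq_zero_of_ae ?_
  filter_upwards [show ∀ᵐ s, s ∉ J → f s = 0 from hf, show ∀ᵐ s, s ∉ K → g s = 0 from hg]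
    with s h1 h2
  by_cases hs : s ∈ J
  · rw [h2 (disjoint_left.1 hJK hs), inner_zero_right, Pi.zero_apply]
  · rw [h1 hs, inner_zero_left, Pi.zero_apply]

theorem rightShift_mem (r : ℝ≥0) (f : L2Plus k) :
    (rightShift k r f : Lp k 2 (volume : Measure ℝ)) ∈ L2 k (Ici (r : ℝ)) := by
  have h1 := Lp.coeFn_compMeasurePreserving f.1 (measurePreserving_sub_right volume (r : ℝ))
  have h2 := (measurePreserving_sub_right volume (r : ℝ)).quasiMeasurePreserving.ae f.2
  filter_upwards [h1, h2] with s hs1 hs2 hs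
  refine hs1.trans (hs2 fun h => hs ?_)
  have h' : (0 : ℝ) ≤ s - r := h
  exact sub_nonneg.1 h'

theorem disjoint_Ico_Ici (t : ℝ≥0) : Disjoint (Ico 0 (t : ℝ)) (Ici (t : ℝ)) :=
  disjoint_left.2 fun _ h1 h2 => not_le.2 h1.2 h2

theorem inner_past_future (t : ℝ≥0) (f : L2 k (Ico 0 (t : ℝ))) (g : L2 k (Ici (t : ℝ))) :
    inner ℂ (past k t f) (future k t g) = 0 :=
  L2.inner_eq_zero (disjoint_Ico_Ici t) f.2 g.2

theorem inner_rightShift_past (r : ℝ≥0) (f : L2Plus k) (g : L2 k (Ico 0 (r : ℝ))) :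
    inner ℂ (rightShift k r f) (past k r g) = 0 :=
  L2.inner_eq_zero (disjoint_Ico_Ici r).symm (rightShift_mem r f) g.2

variable (h : Type v) [NormedAddCommGroup h] [InnerProductSpace ℂ h] (k)

/-- `h ⊗ ℱ`, where `ℱ` is the symmetric Fock space over `L²(ℝ₊; k)`. -/
abbrev HF : Type (max v u) := HTensor h (Fock (L2Plus k))

/-- The identification `h ⊗ ℱ_{[0,t[} ⊗ ℱ_{[t,∞[} = h ⊗ ℱ`. -/
def splitAt (t : ℝ≥0) :
    HTensor (HTensor h (Fock (L2 k (Ico 0 (t : ℝ))))) (Fock (L2 k (Ici (t : ℝ)))) →L[ℂ] HF k h :=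
  factor h (past k t) (future k t)

/-- The identification of `h ⊗ ℱ ⊗ ℱ_{[0,r[}` with `h ⊗ ℱ_{[0,r[} ⊗ ℱ_{[r,∞[} = h ⊗ ℱ` in which
`ℱ` is carried onto `ℱ_{[r,∞[}` by the second quantisation of the right shift `s_r`. -/
def shiftSplit (r : ℝ≥0) :
    HTensor (HF k h) (Fock (L2 k (Ico 0 (r : ℝ)))) →L[ℂ] HF k h :=
  factor h (rightShift k r) (past k r)

variable {k h}

theorem splitAt_apply (t : ℝ≥0) (u : h) (f : L2 k (Ico 0 (t : ℝ))) (g : L2 k (Ici (t : ℝ))) :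
    splitAt k h t (htmul (htmul u (expVec f)) (expVec g)) =
      htmul u (expVec (past k t f + future k t g)) :=
  factor_apply (past k t) (future k t) (inner_past_future t) u f g

theorem shiftSplit_apply (r : ℝ≥0) (u : h) (f : L2Plus k) (g : L2 k (Ico 0 (r : ℝ))) :
    shiftSplit k h r (htmul (htmul u (expVec f)) (expVec g)) =
      htmul u (expVec (rightShift k r f + past k r g)) :=
  factor_apply (rightShift k r) (past k r) (inner_rightShift_past r) u f g

/-- The ampliated CCR flow `σ_r` on `B(h ⊗ ℱ)`: the operator `T` is carried to `h ⊗ ℱ_{[r,∞[}` by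
the right shift and tensored with the identity operator of `ℱ_{[0,r[}`. -/
def ccrFlow (r : ℝ≥0) (T : HF k h →L[ℂ] HF k h) : HF k h →L[ℂ] HF k h :=
  shiftSplit k h r ∘L ampl (Fock (L2 k (Ico 0 (r : ℝ)))) T ∘L (shiftSplit k h r).adjoint

/-- A bounded quantum stochastic process on `h`: each `X_t` lies in
`B(h ⊗ ℱ_{[0,t[}) ⊗ I_{[t,∞[}`. -/
def IsProcess (X : ℝ≥0 → HF k h →L[ℂ] HF k h) : Prop :=
  ∀ t : ℝ≥0, ∃ Z : HTensor h (Fock (L2 k (Ico 0 (t : ℝ)))) →L[ℂ]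
      HTensor h (Fock (L2 k (Ico 0 (t : ℝ)))),
    X t = splitAt k h t ∘L ampl (Fock (L2 k (Ici (t : ℝ)))) Z ∘L (splitAt k h t).adjoint

/-- A left quantum stochastic cocycle on `h`: a bounded quantum stochastic process with `X_0 = I`
and `X_{r+t} = X_r σ_r(X_t)`. -/
structure IsLeftCocycle (X : ℝ≥0 → HF k h →L[ℂ] HF k h) : Prop where
  isProcess : IsProcess X
  map_zero : X 0 = 1
  map_add : ∀ r t, X (r + t) = X r ∘L ccrFlow r (X t)

/-- A left contraction operator quantum stochastic cocycle on `h`. -/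
structure IsLeftContractionCocycle (X : ℝ≥0 → HF k h →L[ℂ] HF k h) : Prop
    extends IsLeftCocycle X where
  contraction : ∀ t, ‖X t‖ ≤ 1

variable (h) in
/-- The operator `E(f) : u ↦ u ⊗ w(f)` from `h` to `h ⊗ ℱ`. -/
def coherent (f : L2Plus k) : h →L[ℂ] HF k h := htmulL.flip (expVec f)

/-- The associated semigroups `X^{x,y}_t = E(x_{[0,t[})^* X_t E(y_{[0,t[})`. -/
def assocSemigroup [CompleteSpace h] (X : ℝ≥0 → HF k h →L[ℂ] HF k h) (x y : k) (t : ℝ≥0) :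
    h →L[ℂ] h :=
  (coherent h (constOn x t)).adjoint ∘L X t ∘L coherent h (constOn y t)

/-- A (one-parameter) semigroup of bounded operators on `h`. -/
structure IsSemigroup (P : ℝ≥0 → h →L[ℂ] h) : Prop where
  map_zero : P 0 = 1
  map_add : ∀ s t, P (s + t) = P s ∘L P t

end Cocycle

/-! ### Matrices over `|h⟩` -/

section Matrices

/-- The matrix `[⟪w(x^i_{[0,t[}), w(x^j_{[0,t[})⟫] = [e^{-t χ(x^i, x^j)}]`. -/
def gram {k : Type u} [NormedAddCommGroup k] [InnerProductSpace ℂ k] {n : ℕ}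
    (x : Fin n → k) (t : ℝ≥0) : Matrix (Fin n) (Fin n) ℂ :=
  Matrix.of fun i j => Complex.exp (-((t : ℝ) : ℂ) * chi (x i) (x j))

variable {h : Type v} [NormedAddCommGroup h] [InnerProductSpace ℂ h] {n : ℕ}

/-- `|h⟩ = B(ℂ; h)`. -/
abbrev Ket (h : Type v) [NormedAddCommGroup h] [InnerProductSpace ℂ h] : Type v := ℂ →L[ℂ] h

/-- The product `L A R` of `A ∈ M_n(|h⟩)` with scalar matrices `L` and `R`. -/
def sandwich (L : Matrix (Fin n) (Fin n) ℂ) (A : Matrix (Fin n) (Fin n) (Ket h))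
    (R : Matrix (Fin n) (Fin n) ℂ) : Matrix (Fin n) (Fin n) (Ket h) :=
  Matrix.of fun i j => ∑ p, ∑ q, (L i p * R q j) • A p q

/-- The Schur product `[P^i_j A^i_j]` of `P ∈ M_n(B(h))` and `A ∈ M_n(|h⟩)`. -/
def schurAction (P : Matrix (Fin n) (Fin n) (h →L[ℂ] h)) (A : Matrix (Fin n) (Fin n) (Ket h)) :
    Matrix (Fin n) (Fin n) (Ket h) :=
  Matrix.of fun i j => P i j ∘L A i j

/-- The operator from `ℂⁿ` to `hⁿ` given by a matrix in `M_n(|h⟩)`. -/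
def matOp (A : Matrix (Fin n) (Fin n) (Ket h)) :
    EuclideanSpace ℂ (Fin n) →L[ℂ] PiLp 2 (fun _ : Fin n => h) :=
  (PiLp.continuousLinearEquiv 2 ℂ (fun _ : Fin n => h)).symm.toContinuousLinearMap ∘L
    ContinuousLinearMap.pi fun i => ∑ j, A i j ∘L EuclideanSpace.proj j

theorem matOp_apply (A : Matrix (Fin n) (Fin n) (Ket h)) (v : EuclideanSpace ℂ (Fin n))
    (i : Fin n) : matOp A v i = ∑ j, A i j (v j) := by
  simp [matOp]

/-- The norm of `M_n(|h⟩) = B(ℂⁿ; hⁿ)`. -/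
def matNorm (A : Matrix (Fin n) (Fin n) (Ket h)) : ℝ := ‖matOp A‖

end Matrices

end QSCocycle

end

noncomputable section

namespace QSCocycle

universe u v

/-! ### Step functions in `L²(ℝ₊; k)`, their shifts, and additivity of `chi` over time -/

section StepFunctions

variable {k : Type u} [NormedAddCommGroup k] [InnerProductSpace ℂ k]

/-! Both directions rest on reading the norm inequality as an estimate of forms. Clearing the
inverse square roots, it says that the form of `S ∘ (λ^{1/2} A μ^{1/2})` at `(w, v)` is at most
`‖A‖` times the square roots of the form of `λ ∘ ϖ` at `w` and of that of `μ ∘ ϖ` at `v`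
(`Dominated`, `matNorm_sandwich_le_iff`). Moreover `ϖ` is the Gram matrix of the exponential vectors
`e i` of the constants `x i` on `[0, t[`, and Schur multiplication by a Gram matrix is tensoring:
the form of `λ ∘ ϖ` at `w` is that of `λ` at the family `w i ⊗ e i`
(`matForm_hadamard_innerMatrix`).

Necessity then concerns a single time. As `S^{x,y}_t` is a compression of `X_t`, the form in
question is a sum of inner products `⟪W p, X_t ((A ⊗ I) V) p⟫`, where `‖W‖²` and `‖V‖²` are exactly
the two forms; Cauchy-Schwarz and `‖A ⊗ I‖ ≤ ‖A‖` finish (`Dominated.htmul_of_contraction`).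

For sufficiency, the hypothesis becomes: if `B` is dominated by `(λ, μ)` then `S_t ∘ B` is dominated
by `(λ ∘ ϖ, μ ∘ ϖ)`. The conclusion has the shape of the premise, so it can be iterated over
successive time intervals with new labels on each. The Gram matrices multiply up to the Gram matrix
of exponential vectors of step functions, and the semigroups multiply up to the `propagator`
(`SchurContractive.dominated_propagator`). Started from `B i j = u j`, dominated by the all-ones
matrix and the Gram matrix of `u`, this bounds the kernel `⟪u, propagator L M v⟫` by the norms of
combinations of the vectors `u ⊗ w(f)`. The starting matrices are in general singular, so the
hypothesis is first extended to positive semidefinite matrices.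

Exponential vectors of `T`-valued step functions are total (`dense_span_expVec_stepAt`), so the
bounded kernel is that of a contraction `Z_t` on `h ⊗ ℱ_{[0,t[}`, and `X_t = Z_t ⊗ I`. The cocycle
identity is multiplicativity of the propagator at a common cut time (`propagator_append`), tested on
exponential vectors cut at `r` and `r + t`. Each matrix element involves finitely many values of the
semigroups, so continuity in time never enters.

Totality holds because `0 ∈ T` turns linear combinations of elements of `T` into affine ones, and a
constant value `y = ∑ a j • x j` with `∑ a j = 1` can be simulated by ever finer blocks with values
`x j`. -/

theorem coeFn_constOn (x : k) (t : ℝ≥0) :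
    ((constOn x t : L2Plus k) : Lp k 2 (volume : Measure ℝ)) =ᵐ[volume]
      (Ico (0 : ℝ) t).indicator fun _ => x :=
  indicatorConstLp_coeFn (hs := measurableSet_Ico) (hμs := by simp)

theorem coeFn_rightShift (r : ℝ≥0) (f : L2Plus k) :
    (rightShift k r f : Lp k 2 (volume : Measure ℝ)) =ᵐ[volume] fun s => f.1 (s - r) :=
  Lp.coeFn_compMeasurePreserving f.1 (measurePreserving_sub_right volume (r : ℝ))

theorem ae_sub_right (r : ℝ) {p : ℝ → Prop} (h : ∀ᵐ s, p s) : ∀ᵐ s, p (s - r) :=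
  (measurePreserving_sub_right volume r).quasiMeasurePreserving.ae h

theorem L2.mono {J K : Set ℝ} (hJK : J ⊆ K) : L2 k J ≤ L2 k K := fun f hf => by
  filter_upwards [show ∀ᵐ s, s ∉ J → f s = 0 from hf] with s hs hsK
  exact hs fun h => hsK (hJK h)

theorem L2.exists_add_compl {J : Set ℝ} (hJ : MeasurableSet J) (f : Lp k 2 (volume : Measure ℝ)) :
    ∃ f₁ ∈ L2 k J, ∃ f₂ ∈ L2 k Jᶜ, f₁ + f₂ = f := by
  have h1 := (Lp.memLp f).indicator hJ
  have h2 := (Lp.memLp f).indicator hJ.compl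
  refine ⟨h1.toLp, ?_, h2.toLp, ?_, Lp.ext ?_⟩
  · filter_upwards [h1.coeFn_toLp] with s hs hs'
    rw [hs, indicator_of_notMem hs']
  · filter_upwards [h2.coeFn_toLp] with s hs hs'
    rw [hs, indicator_of_notMem hs']
  · filter_upwards [Lp.coeFn_add h1.toLp h2.toLp, h1.coeFn_toLp, h2.coeFn_toLp] with s hs hs1 hs2
    rw [hs, Pi.add_apply, hs1, hs2]
    by_cases hsJ : s ∈ J <;> simp [hsJ]

theorem L2.eq_orthogonal {J : Set ℝ} (hJ : MeasurableSet J) : L2 k J = (L2 k Jᶜ)ᗮ := by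
  refine le_antisymm (fun f hf => (Submodule.mem_orthogonal _ _).2 fun g hg =>
    L2.inner_eq_zero disjoint_compl_left hg hf) fun f hf => ?_
  obtain ⟨f₁, h1, f₂, h2, rfl⟩ := L2.exists_add_compl hJ f
  have h3 := Submodule.inner_right_of_mem_orthogonal h2 hf
  rw [inner_add_right, L2.inner_eq_zero disjoint_compl_left h2 h1, zero_add,
    inner_self_eq_zero] at h3
  rwa [h3, add_zero]

theorem L2.isClosed {J : Set ℝ} (hJ : MeasurableSet J) :
    IsClosed (L2 k J : Set (Lp k 2 (volume : Measure ℝ))) := by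
  rw [L2.eq_orthogonal hJ]
  exact Submodule.isClosed_orthogonal _

theorem exists_past_add_future (t : ℝ≥0) (f : L2Plus k) :
    ∃ f₁ f₂, past k t f₁ + future k t f₂ = f := by
  obtain ⟨f₁, h1, f₂, h2, h⟩ := L2.exists_add_compl (measurableSet_Ico (a := 0) (b := (t : ℝ))) f.1
  suffices h6 : f₂ ∈ L2 k (Ici (t : ℝ)) from ⟨⟨f₁, h1⟩, ⟨f₂, h6⟩, Subtype.ext h⟩
  have h3 : f₂ ∈ L2 k (Ici 0) := by
    have h4 : f₂ = f.1 - f₁ := by rw [← h, add_sub_cancel_left]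
    rw [h4]
    exact Submodule.sub_mem _ f.2 (L2.mono Ico_subset_Ici_self h1)
  have h5 : ∀ᵐ s, s ∉ (Ico 0 (t : ℝ))ᶜ → f₂ s = 0 := h2
  filter_upwards [h5, show ∀ᵐ s, s ∉ Ici (0 : ℝ) → f₂ s = 0 from h3] with s hs hs' hst
  by_cases h0 : 0 ≤ s
  · exact hs (not_not_intro ⟨h0, not_le.1 hst⟩)
  · exact hs' h0

/-- Translation back by `r` inverts the shift on functions supported in `[r, ∞[`. It makes the range
of `shiftSplit` dense, hence lets total families be transported through it. -/
theorem exists_rightShift_eq (r : ℝ≥0) (f : L2 k (Ici (r : ℝ))) :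
    ∃ g, rightShift k r g = future k r f := by
  have hmp := measurePreserving_add_right volume (r : ℝ)
  have h1 := Lp.coeFn_compMeasurePreserving f.1 hmp
  have h2 := hmp.quasiMeasurePreserving.ae (show ∀ᵐ s, s ∉ Ici (r : ℝ) → f.1 s = 0 from f.2)
  refine ⟨⟨Lp.compMeasurePreserving (fun s : ℝ => s + r) hmp f.1, ?_⟩,
    Subtype.ext (Lp.ext ?_)⟩
  · filter_upwards [h1, h2] with s hs1 hs2 hs
    rw [hs1]
    refine hs2 fun h => hs ?_
    have h' : (r : ℝ) ≤ s + r := h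
    exact (le_add_iff_nonneg_left (r : ℝ)).1 h'
  · filter_upwards [Lp.coeFn_compMeasurePreserving (Lp.compMeasurePreserving _ hmp f.1)
      (measurePreserving_sub_right volume (r : ℝ)),
      (measurePreserving_sub_right volume (r : ℝ)).quasiMeasurePreserving.ae h1] with s hs1 hs2
    refine hs1.trans (hs2.trans ?_)
    simp only [Function.comp, sub_add_cancel]
    rfl

theorem constOn_mem (x : k) (t : ℝ≥0) :
    (constOn x t : Lp k 2 (volume : Measure ℝ)) ∈ L2 k (Ico 0 (t : ℝ)) := by
  filter_upwards [coeFn_constOn x t] with s hs hs'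
  rw [hs, indicator_of_notMem hs']

theorem rightShift_mem_of_mem {J K : Set ℝ} {r : ℝ≥0} (hJK : ∀ s, s - (r : ℝ) ∈ J → s ∈ K)
    {f : L2Plus k} (hf : (f : Lp k 2 (volume : Measure ℝ)) ∈ L2 k J) :
    (rightShift k r f : Lp k 2 (volume : Measure ℝ)) ∈ L2 k K := by
  filter_upwards [coeFn_rightShift r f,
    ae_sub_right r (show ∀ᵐ s, s ∉ J → f.1 s = 0 from hf)] with s h1 h2 hs
  rw [h1]
  exact h2 fun h => hs (hJK s h)

theorem rightShift_zero (f : L2Plus k) : rightShift k 0 f = f := by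
  refine Subtype.ext (Lp.ext ?_)
  filter_upwards [coeFn_rightShift 0 f] with s hs
  rw [hs, NNReal.coe_zero, sub_zero]

theorem rightShift_add (r s : ℝ≥0) (f : L2Plus k) :
    rightShift k (r + s) f = rightShift k r (rightShift k s f) := by
  refine Subtype.ext (Lp.ext ?_)
  filter_upwards [coeFn_rightShift (r + s) f, coeFn_rightShift r (rightShift k s f),
    ae_sub_right r (coeFn_rightShift s f)] with x h1 h2 h3
  rw [h1, h2, h3, NNReal.coe_add, sub_sub]

theorem constOn_zero_right (x : k) : constOn x 0 = 0 := by
  refine Subtype.ext (Lp.ext ?_)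
  filter_upwards [coeFn_constOn x 0, Lp.coeFn_zero k 2 (volume : Measure ℝ)] with s h1 h2
  rw [h1]
  refine Eq.trans ?_ h2.symm
  simp

theorem constOn_add_right (x : k) (s t : ℝ≥0) :
    constOn x (s + t) = constOn x s + rightShift k s (constOn x t) := by
  refine Subtype.ext (Lp.ext ?_)
  refine Filter.EventuallyEq.trans ?_ (Lp.coeFn_add _ _).symm
  filter_upwards [coeFn_constOn x (s + t), coeFn_constOn x s,
    coeFn_rightShift s (constOn x t), ae_sub_right s (coeFn_constOn x t)] with y h1 h2 h3 h4
  rw [Pi.add_apply, h1, h2, h3, h4]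
  have hs := s.2
  have ht := t.2
  simp only [indicator, mem_Ico, NNReal.coe_add]
  by_cases h0 : 0 ≤ y
  · by_cases hy : y < s
    · have : y < s + t := by have : (0 : ℝ) ≤ t := ht; linarith
      simp [h0, hy, this]
    · have hy' := not_lt.1 hy
      by_cases hyt : y < s + t
      · have : y - s < t := by linarith
        simp [h0, hy, hyt, hy', this]
      · have : ¬ y - s < t := by intro; apply hyt; linarith
        simp [hy, hyt, this]
  · have : ¬ (s : ℝ) ≤ y := fun h => h0 (le_trans hs h)
    simp [h0, this]

theorem constOn_add (x y : k) (t : ℝ≥0) : constOn (x + y) t = constOn x t + constOn y t := by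
  refine Subtype.ext (Lp.ext ?_)
  refine Filter.EventuallyEq.trans ?_ (Lp.coeFn_add _ _).symm
  filter_upwards [coeFn_constOn (x + y) t, coeFn_constOn x t, coeFn_constOn y t] with s h1 h2 h3
  rw [Pi.add_apply, h1, h2, h3]
  by_cases hs : s ∈ Ico (0 : ℝ) t <;> simp [hs]

theorem constOn_smul (c : ℂ) (x : k) (t : ℝ≥0) : constOn (c • x) t = c • constOn x t := by
  refine Subtype.ext (Lp.ext ?_)
  refine Filter.EventuallyEq.trans ?_ (Lp.coeFn_smul _ _).symm
  filter_upwards [coeFn_constOn (c • x) t, coeFn_constOn x t] with s h1 h2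
  rw [Pi.smul_apply, h1, h2]
  by_cases hs : s ∈ Ico (0 : ℝ) t <;> simp [hs]

theorem constOn_zero_left (t : ℝ≥0) : constOn (0 : k) t = 0 := by
  have := constOn_smul (0 : ℂ) (0 : k) t
  rwa [zero_smul, zero_smul] at this

theorem inner_constOn [CompleteSpace k] (x y : k) (t : ℝ≥0) :
    inner ℂ (constOn x t) (constOn y t) = (t : ℝ) * inner ℂ x y := by
  let : NormedSpace ℝ k := NormedSpace.restrictScalars ℝ ℂ k
  have hm : MeasurableSet (Ico (0 : ℝ) t) := measurableSet_Ico
  have hv : volume (Ico (0 : ℝ) t) ≠ ⊤ := by simp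
  refine (L2.inner_indicatorConstLp_indicatorConstLp (𝕜 := ℂ) hm hm hv hv x y).trans ?_
  rw [inter_self]
  simp

theorem norm_constOn_sq [CompleteSpace k] (x : k) (t : ℝ≥0) :
    ‖constOn x t‖ ^ 2 = t * ‖x‖ ^ 2 := by
  have := inner_constOn x x t
  rw [inner_self_eq_norm_sq_to_K (𝕜 := ℂ) (constOn x t), inner_self_eq_norm_sq_to_K] at this
  apply Complex.ofReal_injective
  push_cast
  exact this

theorem chi_constOn [CompleteSpace k] (x y : k) (t : ℝ≥0) :
    chi (constOn x t) (constOn y t) = (t : ℝ) * chi x y := by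
  rw [chi, chi, norm_constOn_sq, norm_constOn_sq, inner_constOn]
  push_cast
  ring

theorem chi_map_isometry {H K : Type*} [NormedAddCommGroup H] [InnerProductSpace ℂ H]
    [NormedAddCommGroup K] [InnerProductSpace ℂ K] (i : H →ₗᵢ[ℂ] K) (f g : H) :
    chi (i f) (i g) = chi f g := by
  rw [chi, chi, i.norm_map, i.norm_map, i.inner_map_map]

theorem chi_self {H : Type*} [NormedAddCommGroup H] [InnerProductSpace ℂ H] (f : H) :
    chi f f = 0 := by
  rw [chi, inner_self_eq_norm_sq_to_K]
  push_cast
  simp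

/-- The supports are disjoint, so the cross terms vanish. Through `inner_expVec` this additivity
becomes multiplication of Gram matrices over successive time intervals. -/
theorem chi_add_rightShift (r : ℝ≥0) {f f' : L2Plus k}
    (hf : (f : Lp k 2 (volume : Measure ℝ)) ∈ L2 k (Ico 0 (r : ℝ)))
    (hf' : (f' : Lp k 2 (volume : Measure ℝ)) ∈ L2 k (Ico 0 (r : ℝ))) (g g' : L2Plus k) :
    chi (f + rightShift k r g) (f' + rightShift k r g') = chi f f' + chi g g' :=
  chi_add_of_orthogonal (past k r) (rightShift k r)
    (fun f g => L2.inner_eq_zero (disjoint_Ico_Ici r) f.2 (rightShift_mem r g))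
    ⟨f, hf⟩ ⟨f', hf'⟩ g g'

/-- The total duration of a list of (value, duration) pairs. -/
def duration {α : Type*} : List (α × ℝ≥0) → ℝ≥0
  | [] => 0
  | p :: L => p.2 + duration L

@[simp] theorem duration_nil {α : Type*} : duration ([] : List (α × ℝ≥0)) = 0 := rfl

@[simp] theorem duration_cons {α : Type*} (p : α × ℝ≥0) (L : List (α × ℝ≥0)) :
    duration (p :: L) = p.2 + duration L := rfl

theorem duration_append {α : Type*} (L M : List (α × ℝ≥0)) :
    duration (L ++ M) = duration L + duration M := by
  induction L with
  | nil => simp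
  | cons p L ih => simp [ih, add_assoc]

theorem duration_map {α β : Type*} (φ : α → β) (L : List (α × ℝ≥0)) :
    duration (L.map (Prod.map φ id)) = duration L := by
  induction L with
  | nil => rfl
  | cons p L ih => simp [ih]

/-- The step function on `ℝ₊` that takes the listed values successively, for the listed durations,
and vanishes afterwards. -/
def stepFn : List (k × ℝ≥0) → L2Plus k
  | [] => 0
  | p :: L => constOn p.1 p.2 + rightShift k p.2 (stepFn L)

@[simp] theorem stepFn_nil : stepFn ([] : List (k × ℝ≥0)) = 0 := rfl

theorem stepFn_cons (x : k) (s : ℝ≥0) (L : List (k × ℝ≥0)) :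
    stepFn ((x, s) :: L) = constOn x s + rightShift k s (stepFn L) := rfl

theorem stepFn_singleton (x : k) (s : ℝ≥0) : stepFn [(x, s)] = constOn x s := by
  rw [stepFn_cons, stepFn_nil, map_zero, add_zero]

theorem stepFn_cons_zero (x : k) (L : List (k × ℝ≥0)) : stepFn ((x, 0) :: L) = stepFn L := by
  rw [stepFn_cons, constOn_zero_right, rightShift_zero, zero_add]

theorem stepFn_cons_add (x : k) (s t : ℝ≥0) (L : List (k × ℝ≥0)) :
    stepFn ((x, s + t) :: L) = stepFn ((x, s) :: (x, t) :: L) := by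
  rw [stepFn_cons, stepFn_cons, stepFn_cons, constOn_add_right, rightShift_add, map_add, add_assoc]

theorem stepFn_append (L M : List (k × ℝ≥0)) :
    stepFn (L ++ M) = stepFn L + rightShift k (duration L) (stepFn M) := by
  induction L with
  | nil => simp [rightShift_zero]
  | cons p L ih =>
    obtain ⟨x, s⟩ := p
    rw [List.cons_append, stepFn_cons, stepFn_cons, ih, map_add, duration_cons, rightShift_add,
      add_assoc]

theorem stepFn_mem (L : List (k × ℝ≥0)) :
    (stepFn L : Lp k 2 (volume : Measure ℝ)) ∈ L2 k (Ico 0 (duration L : ℝ)) := by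
  induction L with
  | nil => exact Submodule.zero_mem _
  | cons p L ih =>
    obtain ⟨x, s⟩ := p
    have hs : (0 : ℝ) ≤ s := s.2
    have hL : (0 : ℝ) ≤ duration L := (duration L).2
    refine Submodule.add_mem _ (L2.mono ?_ (constOn_mem x s)) (rightShift_mem_of_mem ?_ ih)
    · refine Ico_subset_Ico_right ?_
      rw [duration_cons, NNReal.coe_add]
      linarith
    · rintro y ⟨h1, h2⟩
      rw [duration_cons, NNReal.coe_add]
      exact ⟨by linarith, by dsimp only; linarith⟩

theorem chi_stepFn_append {L L' : List (k × ℝ≥0)} (h : duration L = duration L')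
    (M M' : List (k × ℝ≥0)) :
    chi (stepFn (L ++ M)) (stepFn (L' ++ M')) =
      chi (stepFn L) (stepFn L') + chi (stepFn M) (stepFn M') := by
  rw [stepFn_append, stepFn_append, ← h]
  exact chi_add_rightShift _ (stepFn_mem L) (h ▸ stepFn_mem L') _ _

theorem chi_stepFn_cons [CompleteSpace k] (x y : k) (s : ℝ≥0) (L M : List (k × ℝ≥0)) :
    chi (stepFn ((x, s) :: L)) (stepFn ((y, s) :: M)) =
      (s : ℝ) * chi x y + chi (stepFn L) (stepFn M) := by
  rw [stepFn_cons, stepFn_cons, chi_add_rightShift _ (constOn_mem x s) (constOn_mem y s),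
    chi_constOn]

/-- Sums of step functions are step functions. -/
theorem exists_stepFn_add (V : Submodule ℂ k) (n : ℕ) : ∀ L M : List (k × ℝ≥0),
    L.length + M.length ≤ n → duration L = duration M →
    (∀ p ∈ L, p.1 ∈ V) → (∀ p ∈ M, p.1 ∈ V) →
    ∃ N : List (k × ℝ≥0), duration N = duration L ∧ (∀ p ∈ N, p.1 ∈ V) ∧
      stepFn N = stepFn L + stepFn M := by
  induction n with
  | zero =>
    intro L M hn _ _ _
    obtain rfl : L = [] := List.length_eq_zero_iff.1 (by omega)
    obtain rfl : M = [] := List.length_eq_zero_iff.1 (by omega)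
    exact ⟨[], rfl, by simp, by simp⟩
  | succ n ih =>
    intro L M hn hd hL hM
    match L, M with
    | [], M =>
      exact ⟨M, hd.symm, hM, by simp⟩
    | L, [] => exact ⟨L, rfl, hL, by simp⟩
    | (x, a) :: L, (y, b) :: M =>
      have hx : x ∈ V := hL (x, a) (by simp)
      have hy : y ∈ V := hM (y, b) (by simp)
      have hL' : ∀ p ∈ L, p.1 ∈ V := fun p hp => hL p (by simp [hp])
      have hM' : ∀ p ∈ M, p.1 ∈ V := fun p hp => hM p (by simp [hp])
      simp only [duration_cons, List.length_cons] at hd hn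
      rcases le_total a b with hab | hab
      -- The longer head block is cut where the shorter one ends; the total number of remaining
      -- blocks drops by one.
      · obtain ⟨c, rfl⟩ := exists_add_of_le hab
        obtain ⟨N, h1, h2, h3⟩ := ih L ((y, c) :: M) (by simp; omega)
          (by rw [add_assoc] at hd; exact add_left_cancel hd) hL'
          (by rintro p hp; rcases List.mem_cons.1 hp with rfl | hp
              exacts [hy, hM' p hp])
        refine ⟨(x + y, a) :: N, by simp [h1], ?_, ?_⟩
        · intro p hp
          rcases List.mem_cons.1 hp with rfl | hp
          exacts [V.add_mem hx hy, h2 p hp]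
        · rw [stepFn_cons_add, stepFn_cons, stepFn_cons, stepFn_cons y a, h3, constOn_add, map_add]
          abel
      · obtain ⟨c, rfl⟩ := exists_add_of_le hab
        obtain ⟨N, h1, h2, h3⟩ := ih ((x, c) :: L) M (by simp; omega)
          (by rw [add_assoc] at hd; exact add_left_cancel hd)
          (by rintro p hp; rcases List.mem_cons.1 hp with rfl | hp
              exacts [hx, hL' p hp]) hM'
        refine ⟨(x + y, b) :: N, by simp [h1, add_assoc], ?_, ?_⟩
        · intro p hp
          rcases List.mem_cons.1 hp with rfl | hp
          exacts [V.add_mem hx hy, h2 p hp]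
        · rw [stepFn_cons_add, stepFn_cons, stepFn_cons, stepFn_cons y b, h3, constOn_add, map_add]
          abel

theorem stepFn_smul (c : ℂ) (L : List (k × ℝ≥0)) :
    stepFn (L.map (Prod.map (c • ·) id)) = c • stepFn L := by
  induction L with
  | nil => simp
  | cons p L ih =>
    obtain ⟨x, s⟩ := p
    rw [List.map_cons, Prod.map_apply, stepFn_cons, stepFn_cons, ih, id, constOn_smul, map_smul,
      smul_add]

end StepFunctions

open Filter Topology

/-! ### Limits of exponential vectors -/

section Approximation

/-- Expand `‖F a - e‖²`: every term tends to `c`, which is real because it equals `⟪e, e⟫`, and the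
limits cancel. -/
theorem tendsto_of_tendsto_inner {α E : Type*} [NormedAddCommGroup E] [InnerProductSpace ℂ E]
    {l : Filter α} {F : α → E} {e : E} {c : ℂ} (he : inner ℂ e e = c)
    (h1 : Tendsto (fun a => inner ℂ (F a) (F a)) l (𝓝 c))
    (h2 : Tendsto (fun a => inner ℂ (F a) e) l (𝓝 c)) : Tendsto F l (𝓝 e) := by
  have hc : (starRingEnd ℂ) c = c := by rw [← he, inner_conj_symm]
  have h3 : Tendsto (fun a => inner ℂ e (F a)) l (𝓝 c) := by
    have := (Complex.continuous_conj.tendsto c).comp h2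
    rw [hc] at this
    refine this.congr fun a => ?_
    exact inner_conj_symm _ _
  rw [tendsto_iff_norm_sub_tendsto_zero]
  have h4 : Tendsto (fun a => inner ℂ (F a - e) (F a - e)) l (𝓝 0) := by
    have := (h1.sub h2).sub (h3.sub (tendsto_const_nhds (x := c)))
    rw [sub_self] at this
    refine this.congr fun a => ?_
    rw [inner_sub_left, inner_sub_right, inner_sub_right, he]
  have h5 := (Complex.continuous_re.tendsto 0).comp h4
  have h6 := h5.sqrt
  simp only [Complex.zero_re, Real.sqrt_zero] at h6
  exact h6.congr fun a => (norm_eq_sqrt_re_inner (𝕜 := ℂ) _).symm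

theorem continuous_chi {H : Type*} [NormedAddCommGroup H] [InnerProductSpace ℂ H] :
    Continuous fun p : H × H => chi p.1 p.2 := by
  unfold chi
  fun_prop

theorem inner_expVec_self {H : Type*} [NormedAddCommGroup H] [InnerProductSpace ℂ H] (f : H) :
    inner ℂ (expVec f) (expVec f) = (1 : ℂ) := by
  rw [inner_expVec, chi_self, neg_zero, Complex.exp_zero]

theorem continuous_expVec {H : Type*} [NormedAddCommGroup H] [InnerProductSpace ℂ H] :
    Continuous (expVec : H → Fock H) := by
  rw [continuous_iff_continuousAt]
  intro f
  refine tendsto_of_tendsto_inner (inner_expVec_self f)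
    (tendsto_const_nhds.congr fun g => (inner_expVec_self g).symm) ?_
  have h : Continuous fun g : H => inner ℂ (expVec g) (expVec f) := by
    simp only [inner_expVec]
    exact Complex.continuous_exp.comp
      (continuous_chi.comp (continuous_id.prodMk continuous_const)).neg
  have := h.tendsto f
  rwa [inner_expVec_self] at this

/-- Because the weights sum to `1`, the base is `1 + g n / n` with `g n → ∑ a j * d j`, the
derivative at `0` of `z ↦ ∑ a j * exp (d j * z)`. The weights are complex, so no positivity is
involved. -/
theorem tendsto_sum_mul_exp_pow {ι : Type*} [Fintype ι] (a d : ι → ℂ) (ha : ∑ j, a j = 1) :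
    Tendsto (fun n : ℕ => (∑ j, a j * Complex.exp (d j / n)) ^ n) atTop
      (𝓝 (Complex.exp (∑ j, a j * d j))) := by
  have key : ∀ z : ℂ, Tendsto (fun n : ℕ => (n : ℂ) * (Complex.exp (z / n) - 1)) atTop (𝓝 z) := by
    intro z
    have h0 : HasDerivAt (fun w : ℂ => Complex.exp (z * w)) z 0 := by
      have := ((hasDerivAt_id (0 : ℂ)).const_mul z).cexp
      simpa using this
    have h1 : Tendsto (fun n : ℕ => (n : ℂ)⁻¹) atTop (𝓝[≠] 0) := by
      refine tendsto_nhdsWithin_iff.2 ⟨tendsto_inv_atTop_nhds_zero_nat, ?_⟩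
      filter_upwards [eventually_gt_atTop 0] with n hn
      simpa using hn.ne'
    have h2 := (hasDerivAt_iff_tendsto_slope_zero.1 h0).comp h1
    refine h2.congr fun n => ?_
    simp [div_eq_mul_inv]
  have hg : Tendsto (fun n : ℕ => (n : ℂ) * ∑ j, a j * (Complex.exp (d j / n) - 1)) atTop
      (𝓝 (∑ j, a j * d j)) := by
    have := tendsto_finsetSum Finset.univ fun j _ => (key (d j)).const_mul (a j)
    refine this.congr fun n => ?_
    rw [Finset.mul_sum]
    exact Finset.sum_congr rfl fun j _ => by ring
  refine (Complex.tendsto_one_add_pow_exp_of_tendsto hg).congr fun n => ?_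
  simp only [mul_sub, mul_one, Finset.sum_sub_distrib, ha]
  rw [add_sub_cancel]

theorem sum_prod_pow {ι : Type*} [Fintype ι] [DecidableEq ι] (n : ℕ) (g : ι → ι → ℂ) :
    ∑ φ : Fin n → ι, ∑ ψ : Fin n → ι, ∏ l, g (φ l) (ψ l) = (∑ i, ∑ j, g i j) ^ n := by
  rw [Fintype.sum_pow]
  refine Finset.sum_congr rfl fun φ _ => ?_
  rw [Finset.prod_univ_sum, Fintype.piFinset_univ]

end Approximation

/-! ### Totality of exponential vectors of step functions with values in a total set -/

section Totality

variable {k : Type u} [NormedAddCommGroup k] [InnerProductSpace ℂ k]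

/-- The step function given by a list of total duration `t`, as an element of `L²([0, t[; k)`. -/
def stepAt {t : ℝ≥0} (L : List (k × ℝ≥0)) (hL : duration L = t) :
    L2 k (Ico 0 (t : ℝ)) :=
  ⟨stepFn L, hL ▸ stepFn_mem L⟩

theorem past_stepAt {t : ℝ≥0} (L : List (k × ℝ≥0)) (hL : duration L = t) :
    past k t (stepAt L hL) = stepFn L := rfl

theorem chi_stepAt {t : ℝ≥0} {L M : List (k × ℝ≥0)} (hL : duration L = t) (hM : duration M = t) :
    chi (stepAt L hL) (stepAt M hM) = chi (stepFn L) (stepFn M) :=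
  (chi_map_isometry (past k t) _ _).symm

theorem stepAt_congr {t : ℝ≥0} {L M : List (k × ℝ≥0)} (hL : duration L = t) (hM : duration M = t)
    (h : stepFn L = stepFn M) : stepAt L hL = stepAt M hM :=
  (past k t).injective h

theorem duration_ofFn {α : Type*} (n : ℕ) (x : Fin n → α) (c : ℝ≥0) :
    duration (List.ofFn fun l => (x l, c)) = n * c := by
  induction n with
  | zero => simp
  | succ n ih => rw [List.ofFn_succ, duration_cons, ih]; push_cast; ring

theorem chi_stepFn_ofFn [CompleteSpace k] (n : ℕ) (x y : Fin n → k) (c : ℝ≥0) :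
    chi (stepFn (List.ofFn fun l => (x l, c))) (stepFn (List.ofFn fun l => (y l, c))) =
      ∑ l, (c : ℝ) * chi (x l) (y l) := by
  induction n with
  | zero => simp [chi_self]
  | succ n ih => rw [List.ofFn_succ, List.ofFn_succ, chi_stepFn_cons, ih, Fin.sum_univ_succ]

theorem stepFn_ofFn_const_append (y : k) (c : ℝ≥0) (n : ℕ) (M : List (k × ℝ≥0)) :
    stepFn (List.ofFn (fun _ : Fin n => (y, c)) ++ M) = stepFn ((y, n * c) :: M) := by
  induction n with
  | zero => simp [stepFn_cons_zero]
  | succ n ih =>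
    rw [List.ofFn_succ, List.cons_append, stepFn_cons, ih,
      show ((n + 1 : ℕ) : ℝ≥0) * c = c + n * c by push_cast; ring, stepFn_cons_add, stepFn_cons y c]

/-- A list of pairs with values in a subset, viewed in the ambient space. -/
def listVal {k : Type*} {T : Set k} (L : List (T × ℝ≥0)) : List (k × ℝ≥0) := L.map (Prod.map Subtype.val id)

theorem duration_listVal {k : Type*} {T : Set k} (L : List (T × ℝ≥0)) : duration (listVal L) = duration L :=
  duration_map _ L

/-- The defect `1 - ∑ f j` is placed on the vector `0`, which changes the sum of the weights but not
the combination. This is where `0 ∈ T` enters. -/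
theorem exists_affine_combination {T : Set k} (hT0 : (0 : k) ∈ T) {y : k}
    (hy : y ∈ Submodule.span ℂ T) :
    ∃ (n : ℕ) (a : Fin n → ℂ) (x : Fin n → T), ∑ j, a j = 1 ∧ ∑ j, a j • (x j : k) = y := by
  obtain ⟨n, f, g, hfg⟩ := Submodule.mem_span_set'.1 hy
  refine ⟨n + 1, Fin.cons (1 - ∑ j, f j) f, Fin.cons ⟨0, hT0⟩ g, ?_, ?_⟩
  · simp [Fin.sum_univ_succ]
  · simp [Fin.sum_univ_succ, hfg]

/-- Replacing a value by an affine combination of values does not leave the closed span. -/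
theorem tendsto_affine_blocks [CompleteSpace k] {m : ℕ} (a : Fin m → ℂ) (x : Fin m → k)
    (ha : ∑ j, a j = 1) {t s : ℝ≥0} (L M : List (k × ℝ≥0))
    (ht : duration L + (s + duration M) = t) (K : Submodule ℂ (Fock (L2 k (Ico 0 (t : ℝ)))))
    (hKc : IsClosed (K : Set (Fock (L2 k (Ico 0 (t : ℝ))))))
    (hK : ∀ (n : ℕ) (φ : Fin n → Fin m) (c : ℝ≥0)
      (h : duration (L ++ (List.ofFn (fun l => (x (φ l), c)) ++ M)) = t), expVec (stepAt _ h) ∈ K)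
    (h : duration (L ++ (∑ j, a j • x j, s) :: M) = t) :
    expVec (stepAt _ h) ∈ K := by
  set y := ∑ j, a j • x j with hy
  have hdur : ∀ (n : ℕ) (z : Fin (n + 1) → k),
      duration (L ++ (List.ofFn (fun l => (z l, s / (n + 1 : ℕ))) ++ M)) = t := by
    intro n z
    rw [duration_append, duration_append, duration_ofFn, mul_div_cancel₀ _ (by positivity), ht]
  set w : ∀ (n : ℕ) (z : Fin (n + 1) → k), Fock (L2 k (Ico 0 (t : ℝ))) := fun n z =>
    expVec (stepAt _ (hdur n z)) with hw
  have hin : ∀ n z z', inner ℂ (w n z) (w n z') =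
      ∏ l, Complex.exp (-((s : ℝ) * chi (z l) (z' l)) / (n + 1 : ℕ)) := by
    intro n z z'
    rw [hw, inner_expVec, chi_stepAt, chi_stepFn_append rfl,
      chi_stepFn_append (by rw [duration_ofFn, duration_ofFn]), chi_self, chi_self, zero_add,
      add_zero, chi_stepFn_ofFn, ← Complex.exp_sum]
    congr 1
    rw [← Finset.sum_neg_distrib]
    refine Finset.sum_congr rfl fun l _ => ?_
    push_cast
    ring
  -- The target is written with the same subdivision as the approximants, so that inner products
  -- with it factor over the pieces.
  have he : ∀ n, w n (fun _ => y) = expVec (stepAt _ h) := by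
    intro n
    refine congrArg expVec (stepAt_congr _ _ ?_)
    have h2 := stepFn_ofFn_const_append y (s / (n + 1 : ℕ)) (n + 1) M
    rw [mul_div_cancel₀ _ (by positivity)] at h2
    rw [stepFn_append L, stepFn_append L]
    exact congrArg (fun z => stepFn L + rightShift k (duration L) z) h2
  -- The exponential factor replaces the normalisation that a piece with value `x j` contributes to
  -- a coherent vector by the one that belongs to `y`.
  set b : ℕ → Fin m → ℂ := fun n j =>
    a j * Complex.exp (((s : ℝ) * ((‖x j‖ ^ 2 - ‖y‖ ^ 2) / 2 : ℝ)) / (n + 1 : ℕ)) with hb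
  -- The expanded product, over the `n + 1` pieces of the block, of the combinations `∑ j` of `x
  -- j`-valued pieces with weights `b n j`.
  set F : ℕ → Fock (L2 k (Ico 0 (t : ℝ))) := fun n =>
    ∑ φ : Fin (n + 1) → Fin m, (∏ l, b n (φ l)) • w n (fun l => x (φ l)) with hF
  have hFmem : ∀ n, F n ∈ K := fun n =>
    K.sum_mem fun φ _ => K.smul_mem _ (hK _ φ _ _)
  have hxy : ∑ j, a j * inner ℂ y (x j) = (‖y‖ ^ 2 : ℝ) := by
    have h1 : inner ℂ y y = ∑ j, a j * inner ℂ y (x j) := by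
      rw [show inner ℂ y y = inner ℂ y (∑ j, a j • x j) by rw [← hy], inner_sum]
      simp only [inner_smul_right]
    rw [← h1, inner_self_eq_norm_sq_to_K (𝕜 := ℂ)]
    push_cast
    rfl
  have hyx : ∑ j, (starRingEnd ℂ) (a j) * inner ℂ (x j) y = (‖y‖ ^ 2 : ℝ) := by
    have := congrArg (starRingEnd ℂ) hxy
    rw [map_sum] at this
    simpa only [map_mul, inner_conj_symm, Complex.conj_ofReal] using this
  have hac : ∑ j, (starRingEnd ℂ) (a j) = 1 := by rw [← map_sum, ha, map_one]
  -- The inner product is an `(n + 1)`-th power, with limit given by `tendsto_sum_mul_exp_pow`. The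
  -- exponent in the limit is `s` times `∑ conj (a j) * (⟪x j, y⟫ - ‖y‖²)`, which vanishes since `∑
  -- a j = 1` and `∑ a j • x j = y`. The computation for `⟪F n, F n⟫` is the same with index pairs.
  have hFe : Tendsto (fun n => inner ℂ (F n) (expVec (stepAt _ h))) atTop (𝓝 1) := by
    have h1 : Tendsto (fun n : ℕ => (∑ j, (starRingEnd ℂ) (a j) *
        Complex.exp ((s : ℝ) * (inner ℂ (x j) y - (‖y‖ ^ 2 : ℝ)) / n)) ^ n) atTop (𝓝 1) := by
      have := tendsto_sum_mul_exp_pow (fun j => (starRingEnd ℂ) (a j))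
        (fun j => (s : ℝ) * (inner ℂ (x j) y - (‖y‖ ^ 2 : ℝ))) hac
      convert this using 2
      symm
      rw [Complex.exp_eq_one_iff]
      refine ⟨0, ?_⟩
      simp only [mul_sub, mul_left_comm _ ((s : ℝ) : ℂ), Finset.sum_sub_distrib, ← Finset.mul_sum,
        ← Finset.sum_mul, hyx, hac]
      simp
    refine ((tendsto_add_atTop_iff_nat 1).2 h1).congr fun n => ?_
    rw [Fintype.sum_pow, hF, sum_inner]
    refine Finset.sum_congr rfl fun φ _ => ?_
    rw [inner_smul_left, ← he n, hin, map_prod, ← Finset.prod_mul_distrib]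
    refine Finset.prod_congr rfl fun l _ => ?_
    rw [hb, map_mul, ← Complex.exp_conj, mul_assoc, ← Complex.exp_add]
    congr 2
    simp only [map_div₀, map_mul, Complex.conj_ofReal, map_natCast, chi]
    push_cast
    ring
  have hFF : Tendsto (fun n => inner ℂ (F n) (F n)) atTop (𝓝 1) := by
    have h1 : Tendsto (fun n : ℕ => (∑ p : Fin m × Fin m, (starRingEnd ℂ) (a p.1) * a p.2 *
        Complex.exp ((s : ℝ) * (inner ℂ (x p.1) (x p.2) - (‖y‖ ^ 2 : ℝ)) / n)) ^ n) atTop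
        (𝓝 1) := by
      have hs : ∑ p : Fin m × Fin m, (starRingEnd ℂ) (a p.1) * a p.2 = 1 := by
        rw [Fintype.sum_prod_type]
        simp only [← Finset.mul_sum, ha, mul_one, hac]
      have := tendsto_sum_mul_exp_pow (fun p : Fin m × Fin m => (starRingEnd ℂ) (a p.1) * a p.2)
        (fun p => (s : ℝ) * (inner ℂ (x p.1) (x p.2) - (‖y‖ ^ 2 : ℝ))) hs
      convert this using 2
      symm
      rw [Complex.exp_eq_one_iff]
      refine ⟨0, ?_⟩
      have h2 : ∑ p : Fin m × Fin m, (starRingEnd ℂ) (a p.1) * a p.2 * inner ℂ (x p.1) (x p.2) =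
          (‖y‖ ^ 2 : ℝ) := by
        rw [← hyx, Fintype.sum_prod_type]
        refine Finset.sum_congr rfl fun i _ => ?_
        rw [hy, inner_sum, Finset.mul_sum]
        refine Finset.sum_congr rfl fun j _ => ?_
        rw [inner_smul_right]
        ring
      simp only [mul_sub, mul_left_comm _ ((s : ℝ) : ℂ), Finset.sum_sub_distrib, ← Finset.mul_sum,
        ← Finset.sum_mul, h2, hs]
      simp
    refine ((tendsto_add_atTop_iff_nat 1).2 h1).congr fun n => ?_
    rw [Fintype.sum_prod_type, ← sum_prod_pow (n + 1) (fun i j => (starRingEnd ℂ) (a i) * a j *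
      Complex.exp ((s : ℝ) * (inner ℂ (x i) (x j) - (‖y‖ ^ 2 : ℝ)) / (n + 1 : ℕ))), hF, sum_inner]
    refine Finset.sum_congr rfl fun φ _ => ?_
    rw [inner_sum]
    refine Finset.sum_congr rfl fun ψ _ => ?_
    rw [inner_smul_left, inner_smul_right, hin, map_prod, ← Finset.prod_mul_distrib,
      ← Finset.prod_mul_distrib]
    refine Finset.prod_congr rfl fun l _ => ?_
    rw [hb, map_mul, ← Complex.exp_conj]
    rw [show ∀ p q r t v : ℂ, p * q * (r * t * v) = p * r * (q * (t * v)) from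
      fun _ _ _ _ _ => by ring, ← Complex.exp_add, ← Complex.exp_add]
    congr 2
    simp only [map_div₀, map_mul, Complex.conj_ofReal, map_natCast, chi]
    push_cast
    ring
  exact hKc.mem_of_tendsto (tendsto_of_tendsto_inner (inner_expVec_self _) hFF hFe)
    (Eventually.of_forall hFmem)

/-- Induction on the blocks `M` still allowed values in the span; the prefix `L` already has values
in `T`. `tendsto_affine_blocks` trades the head of `M` for finitely many `T`-valued blocks, which
join the prefix. -/
theorem expVec_stepAt_mem [CompleteSpace k] {T : Set k} (hT0 : (0 : k) ∈ T) {t : ℝ≥0}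
    (K : Submodule ℂ (Fock (L2 k (Ico 0 (t : ℝ)))))
    (hKc : IsClosed (K : Set (Fock (L2 k (Ico 0 (t : ℝ))))))
    (hK : ∀ (L : List (T × ℝ≥0)) (h : duration (listVal L) = t), expVec (stepAt _ h) ∈ K)
    (M : List (k × ℝ≥0)) (hM : ∀ p ∈ M, p.1 ∈ Submodule.span ℂ T) :
    ∀ (L : List (T × ℝ≥0)) (h : duration (listVal L ++ M) = t), expVec (stepAt _ h) ∈ K := by
  induction M with
  | nil =>
    intro L h
    have h' : duration (listVal L) = t := by rwa [List.append_nil] at h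
    rw [stepAt_congr h h' (by rw [List.append_nil])]
    exact hK L h'
  | cons p M ih =>
    obtain ⟨y, s⟩ := p
    intro L h
    obtain ⟨m, a, x, ha, hy⟩ := exists_affine_combination hT0 (hM (y, s) (by simp))
    subst hy
    refine tendsto_affine_blocks a (fun j => (x j : k)) ha (listVal L) M
      (by rwa [duration_append] at h) K hKc (fun n φ c h' => ?_) h
    have he : listVal L ++ (List.ofFn (fun l => ((x (φ l) : k), c)) ++ M) =
        listVal (L ++ List.ofFn fun l => (x (φ l), c)) ++ M := by
      rw [← List.append_assoc]
      simp [listVal, List.map_ofFn, Function.comp_def]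
    have h'' := h'
    rw [he] at h''
    rw [stepAt_congr h' h'' (by rw [he])]
    exact ih (fun p hp => hM p (by simp [hp])) _ _

/-- Lebesgue differentiation: almost everywhere `g` is the derivative of its primitive, and the
primitive vanishes on `[0, t]`. -/
theorem eq_zero_of_setIntegral_Ico_eq_zero [CompleteSpace k] {t : ℝ≥0}
    {g : L2 k (Ico 0 (t : ℝ))} (hg : letI := NormedSpace.restrictScalars ℝ ℂ k
      ∀ s : ℝ≥0, s ≤ t → ∫ y in Ico (0 : ℝ) s, g.1 y = 0) : g = 0 := by
  let : NormedSpace ℝ k := NormedSpace.restrictScalars ℝ ℂ k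
  refine Subtype.ext (Lp.ext ?_)
  have hloc : LocallyIntegrable (g.1 : ℝ → k) volume :=
    (Lp.memLp g.1).locallyIntegrable (by norm_num)
  refine Filter.EventuallyEq.trans ?_ (Lp.coeFn_zero k 2 (volume : Measure ℝ)).symm
  have h0 : ∀ᵐ x : ℝ, x ≠ 0 := by simp [ae_iff, measure_singleton]
  filter_upwards [LocallyIntegrable.ae_hasDerivAt_integral hloc,
    show ∀ᵐ s, s ∉ Ico 0 (t : ℝ) → g.1 s = 0 from g.2, h0] with x hx hx' hx0
  by_cases hxt : x ∈ Ico 0 (t : ℝ)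
  · have h1 : (fun z : ℝ => ∫ y in (0 : ℝ)..z, g.1 y) =ᶠ[𝓝 x] fun _ => 0 := by
      filter_upwards [Ioo_mem_nhds (lt_of_le_of_ne hxt.1 hx0.symm) hxt.2] with z hz
      rw [intervalIntegral.integral_of_le hz.1.le, ← integral_Ico_eq_integral_Ioc]
      exact hg ⟨z, hz.1.le⟩ hz.2.le
    exact (hx 0).unique ((hasDerivAt_const x (0 : k)).congr_of_eventuallyEq h1)
  · exact hx' hxt

/-- The step functions on `[0, t[` with values in a subspace. -/
def stepSpace (V : Submodule ℂ k) (t : ℝ≥0) : Submodule ℂ (L2 k (Ico 0 (t : ℝ))) where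
  carrier := {f | ∃ (L : List (k × ℝ≥0)) (h : duration L = t),
    (∀ p ∈ L, p.1 ∈ V) ∧ stepAt L h = f}
  zero_mem' := ⟨[(0, t)], by simp, by simp, (past k t).injective (by
    rw [past_stepAt, stepFn_singleton, constOn_zero_left, map_zero])⟩
  add_mem' := by
    rintro _ _ ⟨L, hL, hLV, rfl⟩ ⟨M, hM, hMV, rfl⟩
    obtain ⟨N, h1, h2, h3⟩ := exists_stepFn_add V _ L M le_rfl (hL.trans hM.symm) hLV hMV
    exact ⟨N, h1.trans hL, h2, (past k t).injective (by simpa only [map_add, past_stepAt] using h3)⟩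
  smul_mem' := by
    rintro c _ ⟨L, hL, hLV, rfl⟩
    refine ⟨L.map (Prod.map (c • ·) id), (duration_map _ L).trans hL, ?_,
      (past k t).injective (by rw [map_smul, past_stepAt, past_stepAt, stepFn_smul])⟩
    intro p hp
    obtain ⟨q, hq, rfl⟩ := List.mem_map.1 hp
    exact V.smul_mem c (hLV q hq)

theorem stepSpace_dense [CompleteSpace k] {T : Set k}
    (hT : (Submodule.span ℂ T).topologicalClosure = ⊤) (t : ℝ≥0) :
    (stepSpace (Submodule.span ℂ T) t).topologicalClosure = ⊤ := by
  have : CompleteSpace (L2 k (Ico 0 (t : ℝ))) :=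
    (L2.isClosed measurableSet_Ico).completeSpace_coe
  let : NormedSpace ℝ k := NormedSpace.restrictScalars ℝ ℂ k
  rw [Submodule.topologicalClosure_eq_top_iff, Submodule.eq_bot_iff]
  intro g hg
  refine eq_zero_of_setIntegral_Ico_eq_zero fun s hs => ?_
  rw [Submodule.topologicalClosure_eq_top_iff] at hT
  rw [← Submodule.mem_bot ℂ, ← hT, Submodule.mem_orthogonal]
  intro x hx
  -- Padding by the value `0` brings the total duration to `t`. Orthogonality of `g` to this
  -- function says that `x` is orthogonal to the integral of `g` over `[0, s[`.
  have h1 : stepAt [(x, s), (0, t - s)] (by simp [hs]) ∈ stepSpace (Submodule.span ℂ T) t :=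
    ⟨_, _, by simp [hx], rfl⟩
  have h2 := Submodule.inner_right_of_mem_orthogonal h1 hg
  rw [← (past k t).inner_map_map, past_stepAt, stepFn_cons, stepFn_singleton, constOn_zero_left,
    map_zero, add_zero] at h2
  refine Eq.trans ?_ h2
  exact (L2.inner_indicatorConstLp_eq_inner_setIntegral ℂ measurableSet_Ico (by simp) x g.1).symm

/-- The exponential vectors of step functions with values in a total set containing `0` are
total. -/
theorem dense_span_expVec_stepAt [CompleteSpace k] {T : Set k} (hT0 : (0 : k) ∈ T)
    (hT : (Submodule.span ℂ T).topologicalClosure = ⊤) (t : ℝ≥0) :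
    (Submodule.span ℂ (range fun L : {L : List (T × ℝ≥0) // duration (listVal L) = t} =>
      expVec (stepAt (listVal L.1) L.2))).topologicalClosure = ⊤ := by
  set K := (Submodule.span ℂ (range fun L : {L : List (T × ℝ≥0) // duration (listVal L) = t} =>
      expVec (stepAt (listVal L.1) L.2))).topologicalClosure with hKdef
  have hKc : IsClosed (K : Set (Fock (L2 k (Ico 0 (t : ℝ))))) :=
    Submodule.isClosed_topologicalClosure _
  have h1 : ∀ f ∈ stepSpace (Submodule.span ℂ T) t, expVec f ∈ K := by
    rintro _ ⟨M, hM, hMV, rfl⟩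
    exact expVec_stepAt_mem hT0 K hKc (fun L h => Submodule.le_topologicalClosure _
      (Submodule.subset_span ⟨⟨L, h⟩, rfl⟩)) M hMV [] hM
  have h2 : ∀ f, expVec f ∈ K := by
    intro f
    have hd : Dense (stepSpace (Submodule.span ℂ T) t : Set (L2 k (Ico 0 (t : ℝ)))) :=
      Submodule.dense_iff_topologicalClosure_eq_top.2 (stepSpace_dense hT t)
    exact hd.induction h1 (hKc.preimage continuous_expVec) f
  rw [eq_top_iff, ← dense_span_expVec]
  refine Submodule.topologicalClosure_minimal _ (Submodule.span_le.2 ?_) hKc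
  rintro _ ⟨f, rfl⟩
  exact h2 f

end Totality

open Matrix

/-! ### Forms of scalar matrices on families of vectors, and domination -/

section Matrices

variable {n : ℕ} {E : Type*} [NormedAddCommGroup E] [InnerProductSpace ℂ E]

/-- The vector with entries `∑ i, K p i • w i`. -/
def matAct (K : Matrix (Fin n) (Fin n) ℂ) (w : Fin n → E) : Fin n → E := fun p => ∑ i, K p i • w i

/-- The value `∑ i j, l i j ⟪w i, w j⟫` of the form of a Hermitian matrix. -/
def matForm (l : Matrix (Fin n) (Fin n) ℂ) (w : Fin n → E) : ℝ :=
  (∑ i, ∑ j, l i j * inner ℂ (w i) (w j)).re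

theorem matAct_mul (K L : Matrix (Fin n) (Fin n) ℂ) (w : Fin n → E) :
    matAct (K * L) w = matAct K (matAct L w) := by
  funext p
  simp only [matAct, Matrix.mul_apply, Finset.sum_smul, Finset.smul_sum, smul_smul]
  exact Finset.sum_comm

theorem matAct_one (w : Fin n → E) : matAct 1 w = w := by
  funext p
  simp [matAct, Matrix.one_apply]

theorem matForm_conjTranspose_mul_self (K : Matrix (Fin n) (Fin n) ℂ) (w : Fin n → E) :
    matForm (Kᴴ * K) w = ∑ p, ‖matAct K w p‖ ^ 2 := by
  have h : ∑ i, ∑ j, (Kᴴ * K) i j * inner ℂ (w i) (w j) =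
      ∑ p, inner ℂ (matAct K w p) (matAct K w p) := by
    simp only [matAct, Matrix.mul_apply, Finset.sum_mul, sum_inner, inner_sum, inner_smul_left,
      inner_smul_right, Matrix.conjTranspose_apply, RCLike.star_def]
    rw [Finset.sum_comm_cycle]
    refine Finset.sum_congr rfl fun p _ => ?_
    rw [Finset.sum_comm]
    refine Finset.sum_congr rfl fun i _ => ?_
    rw [Finset.mul_sum]
    exact Finset.sum_congr rfl fun j _ => by ring
  rw [matForm, h, Complex.re_sum]
  exact Finset.sum_congr rfl fun p _ => inner_self_eq_norm_sq (𝕜 := ℂ) _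

theorem matForm_one (w : Fin n → E) : matForm 1 w = ∑ i, ‖w i‖ ^ 2 := by
  have := matForm_conjTranspose_mul_self (1 : Matrix (Fin n) (Fin n) ℂ) w
  rwa [conjTranspose_one, one_mul, matAct_one] at this

theorem matForm_add (l m : Matrix (Fin n) (Fin n) ℂ) (w : Fin n → E) :
    matForm (l + m) w = matForm l w + matForm m w := by
  simp only [matForm, Matrix.add_apply, add_mul, Finset.sum_add_distrib, Complex.add_re]

theorem matForm_smul (c : ℝ) (l : Matrix (Fin n) (Fin n) ℂ) (w : Fin n → E) :
    matForm ((c : ℂ) • l) w = c * matForm l w := by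
  simp only [matForm, Matrix.smul_apply, smul_eq_mul, mul_assoc, ← Finset.mul_sum,
    Complex.re_ofReal_mul]

theorem sqrt_mul_sqrt {l : Matrix (Fin n) (Fin n) ℂ} (hl : l.PosSemidef) :
    CFC.sqrt l * CFC.sqrt l = l :=
  CFC.sqrt_mul_sqrt_self l hl.nonneg

theorem conjTranspose_sqrt (l : Matrix (Fin n) (Fin n) ℂ) :
    (CFC.sqrt l)ᴴ = CFC.sqrt l :=
  (Matrix.nonneg_iff_posSemidef.1 (CFC.sqrt_nonneg l)).1

theorem matForm_eq_sqrt {l : Matrix (Fin n) (Fin n) ℂ} (hl : l.PosSemidef) (w : Fin n → E) :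
    matForm l w = ∑ p, ‖matAct (CFC.sqrt l) w p‖ ^ 2 := by
  rw [← matForm_conjTranspose_mul_self, conjTranspose_sqrt, sqrt_mul_sqrt hl]

theorem matForm_nonneg {l : Matrix (Fin n) (Fin n) ℂ} (hl : l.PosSemidef) (w : Fin n → E) :
    0 ≤ matForm l w := by
  rw [matForm_eq_sqrt hl]
  positivity

/-- The matrix of inner products of a family of vectors. -/
def innerMatrix {F : Type*} [NormedAddCommGroup F] [InnerProductSpace ℂ F] (e : Fin n → F) :
    Matrix (Fin n) (Fin n) ℂ := Matrix.of fun i j => inner ℂ (e i) (e j)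

theorem posSemidef_innerMatrix {F : Type*} [NormedAddCommGroup F] [InnerProductSpace ℂ F]
    (e : Fin n → F) : (innerMatrix e).PosSemidef := Matrix.posSemidef_gram ℂ e

/-- The bridge between Schur products and Fock space: multiplying by a Gram matrix entrywise amounts
to tensoring the test vectors with the vectors of the family. -/
theorem matForm_hadamard_innerMatrix {F : Type*} [NormedAddCommGroup F] [InnerProductSpace ℂ F]
    (l : Matrix (Fin n) (Fin n) ℂ) (e : Fin n → F) (w : Fin n → E) :
    matForm (l.hadamard (innerMatrix e)) w = matForm l fun i => htmul (w i) (e i) := by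
  simp only [matForm, inner_htmul, hadamard_apply, innerMatrix, of_apply]
  congr 1
  exact Finset.sum_congr rfl fun i _ => Finset.sum_congr rfl fun j _ => by ring

theorem matForm_complex_hadamard_innerMatrix {F : Type*} [NormedAddCommGroup F]
    [InnerProductSpace ℂ F] (l : Matrix (Fin n) (Fin n) ℂ) (e : Fin n → F) (v : Fin n → ℂ) :
    matForm (l.hadamard (innerMatrix e)) v = matForm l fun i => v i • e i := by
  simp only [matForm, hadamard_apply, innerMatrix, of_apply, inner_smul_left, inner_smul_right,
    RCLike.inner_apply]
  congr 1
  exact Finset.sum_congr rfl fun i _ => Finset.sum_congr rfl fun j _ => by ring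

theorem posSemidef_of_matForm {l : Matrix (Fin n) (Fin n) ℂ} (hl : l.IsHermitian)
    (h : ∀ v : Fin n → ℂ, 0 ≤ matForm l v) : l.PosSemidef := by
  refine posSemidef_iff_dotProduct_mulVec.2 ⟨hl, fun v => ?_⟩
  have h1 : star v ⬝ᵥ l *ᵥ v = ∑ i, ∑ j, l i j * inner ℂ (v i) (v j) := by
    simp only [dotProduct, mulVec, Finset.mul_sum, RCLike.inner_apply, Pi.star_apply,
      RCLike.star_def]
    exact Finset.sum_congr rfl fun i _ => Finset.sum_congr rfl fun j _ => by ring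
  rw [RCLike.nonneg_iff]
  refine ⟨?_, hl.im_star_dotProduct_mulVec_self v⟩
  rw [h1]
  exact h v

theorem posDef_of_matForm {l : Matrix (Fin n) (Fin n) ℂ} (hl : l.PosSemidef)
    (h : ∀ v : Fin n → ℂ, matForm l v = 0 → v = 0) : l.PosDef := by
  refine posDef_iff_dotProduct_mulVec.2 ⟨hl.1, fun v hv => ?_⟩
  refine lt_of_le_of_ne (hl.dotProduct_mulVec_nonneg v) fun h0 => hv (h v ?_)
  have h1 : star v ⬝ᵥ l *ᵥ v = ∑ i, ∑ j, l i j * inner ℂ (v i) (v j) := by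
    simp only [dotProduct, mulVec, Finset.mul_sum, RCLike.inner_apply, Pi.star_apply,
      RCLike.star_def]
    exact Finset.sum_congr rfl fun i _ => Finset.sum_congr rfl fun j _ => by ring
  rw [matForm, ← h1, ← h0, Complex.zero_re]

theorem isUnit_det_sqrt {l : Matrix (Fin n) (Fin n) ℂ} (hl : l.PosDef) :
    IsUnit (CFC.sqrt l).det := by
  have h := hl.isUnit
  rw [← sqrt_mul_sqrt hl.posSemidef, Matrix.isUnit_iff_isUnit_det, Matrix.det_mul] at h
  exact isUnit_of_mul_isUnit_left h

/-- If the form vanishes at `v`, invertibility of the square root of `l` forces every `v i • e i` to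
vanish. The vectors `e i` only have to be nonzero, not independent, so repeated labels are covered.
-/
theorem posDef_hadamard_innerMatrix {F : Type*} [NormedAddCommGroup F] [InnerProductSpace ℂ F]
    {l : Matrix (Fin n) (Fin n) ℂ} (hl : l.PosDef) {e : Fin n → F} (he : ∀ i, e i ≠ 0) :
    (l.hadamard (innerMatrix e)).PosDef := by
  refine posDef_of_matForm (hl.posSemidef.hadamard (posSemidef_innerMatrix e)) fun v hv => ?_
  rw [matForm_complex_hadamard_innerMatrix, matForm_eq_sqrt hl.posSemidef,
    Finset.sum_eq_zero_iff_of_nonneg fun _ _ => by positivity] at hv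
  have h1 : matAct (CFC.sqrt l) (fun i => v i • e i) = 0 := by
    funext p
    simpa using hv p (Finset.mem_univ p)
  have h2 : (fun i => v i • e i) = 0 := by
    rw [← matAct_one (fun i => v i • e i), ← Matrix.nonsing_inv_mul _ (isUnit_det_sqrt hl),
      matAct_mul, h1]
    funext p
    simp [matAct]
  funext i
  exact (smul_eq_zero.1 (congrFun h2 i)).resolve_right (he i)

variable {h : Type v} [NormedAddCommGroup h] [InnerProductSpace ℂ h]

/-- The form `(w, v) ↦ ⟪w, B v⟫` of a matrix with entries in `h`. -/
def matPair (B : Matrix (Fin n) (Fin n) h) (w : Fin n → h) (v : Fin n → ℂ) : ℂ :=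
  ∑ i, ∑ j, v j * inner ℂ (w i) (B i j)

/-- The matrix of vectors that corresponds to a matrix over `|h⟩`. -/
def ketVec (A : Matrix (Fin n) (Fin n) (Ket h)) : Matrix (Fin n) (Fin n) h := A.map fun a => a 1

/-- The matrix over `|h⟩` that corresponds to a matrix of vectors. -/
def vecKet (B : Matrix (Fin n) (Fin n) h) : Matrix (Fin n) (Fin n) (Ket h) :=
  B.map fun b => ContinuousLinearMap.toSpanSingleton ℂ b

theorem ketVec_vecKet (B : Matrix (Fin n) (Fin n) h) : ketVec (vecKet B) = B := by
  ext i j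
  simp [ketVec, vecKet]

theorem ketVec_schurAction (P : Matrix (Fin n) (Fin n) (h →L[ℂ] h))
    (A : Matrix (Fin n) (Fin n) (Ket h)) :
    ketVec (schurAction P A) = Matrix.of fun i j => P i j (ketVec A i j) := rfl

theorem matPair_sandwich (L R : Matrix (Fin n) (Fin n) ℂ) (A : Matrix (Fin n) (Fin n) (Ket h))
    (w : Fin n → h) (v : Fin n → ℂ) :
    matPair (ketVec (sandwich L A R)) w v = matPair (ketVec A) (matAct Lᴴ w) (matAct R v) := by
  simp only [matPair, ketVec, sandwich, matAct, Matrix.map_apply, of_apply,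
    _root_.sum_apply, _root_.smul_apply, inner_sum, sum_inner,
    inner_smul_left, inner_smul_right, conjTranspose_apply, RCLike.star_def, Complex.conj_conj,
    smul_eq_mul, Finset.mul_sum, Finset.sum_mul]
  calc _ = ∑ i, ∑ p, ∑ q, ∑ j, v j * (L i p * R q j * inner ℂ (w i) (A p q 1)) := by
        refine Finset.sum_congr rfl fun i _ => ?_
        rw [Finset.sum_comm]
        refine Finset.sum_congr rfl fun p _ => Finset.sum_comm
    _ = ∑ p, ∑ q, ∑ j, ∑ i, v j * (L i p * R q j * inner ℂ (w i) (A p q 1)) := by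
        rw [Finset.sum_comm]
        refine Finset.sum_congr rfl fun p _ => ?_
        rw [Finset.sum_comm]
        refine Finset.sum_congr rfl fun q _ => Finset.sum_comm
    _ = _ := by
        refine Finset.sum_congr rfl fun p _ => Finset.sum_congr rfl fun q _ => ?_
        rw [Finset.sum_comm]
        refine Finset.sum_congr rfl fun i _ => Finset.sum_congr rfl fun j _ => by ring

theorem sandwich_sandwich (L L' R R' : Matrix (Fin n) (Fin n) ℂ)
    (A : Matrix (Fin n) (Fin n) (Ket h)) :
    sandwich L (sandwich L' A R') R = sandwich (L * L') A (R' * R) := by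
  ext1 i j
  simp only [sandwich, of_apply, Finset.smul_sum, smul_smul, Matrix.mul_apply, Finset.sum_mul_sum,
    Finset.sum_smul]
  calc _ = ∑ a : Fin n × Fin n, ∑ b : Fin n × Fin n,
          (L i a.1 * R a.2 j * (L' a.1 b.1 * R' b.2 a.2)) • A b.1 b.2 := by
        simp only [Fintype.sum_prod_type]
    _ = ∑ b : Fin n × Fin n, ∑ a : Fin n × Fin n,
          (L i a.1 * R a.2 j * (L' a.1 b.1 * R' b.2 a.2)) • A b.1 b.2 := Finset.sum_comm
    _ = _ := by
        simp only [Fintype.sum_prod_type]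
        refine Finset.sum_congr rfl fun p' _ => Finset.sum_congr rfl fun q' _ =>
          Finset.sum_congr rfl fun p _ => Finset.sum_congr rfl fun q _ => ?_
        congr 1
        ring

theorem sandwich_one (A : Matrix (Fin n) (Fin n) (Ket h)) : sandwich 1 A 1 = A := by
  ext1 i j
  simp [sandwich, Matrix.one_apply]

theorem inner_matOp (A : Matrix (Fin n) (Fin n) (Ket h)) (w : PiLp 2 fun _ : Fin n => h)
    (v : EuclideanSpace ℂ (Fin n)) :
    inner ℂ w (matOp A v) = matPair (ketVec A) (fun i => w i) (fun j => v j) := by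
  rw [PiLp.inner_apply]
  refine Finset.sum_congr rfl fun i _ => ?_
  rw [matOp_apply, inner_sum]
  refine Finset.sum_congr rfl fun j _ => ?_
  rw [← inner_smul_right, ketVec, Matrix.map_apply, ← map_smul, smul_eq_mul, mul_one]

theorem matNorm_nonneg (A : Matrix (Fin n) (Fin n) (Ket h)) : 0 ≤ matNorm A :=
  norm_nonneg (matOp A)

theorem matNorm_le_iff (A : Matrix (Fin n) (Fin n) (Ket h)) {C : ℝ} (hC : 0 ≤ C) :
    matNorm A ≤ C ↔ ∀ (w : Fin n → h) (v : Fin n → ℂ), ‖matPair (ketVec A) w v‖ ≤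
      C * √(∑ i, ‖w i‖ ^ 2) * √(∑ j, ‖v j‖ ^ 2) := by
  constructor
  · intro hA w v
    have h1 := inner_matOp A (WithLp.toLp 2 w) (WithLp.toLp 2 v)
    rw [← PiLp.norm_eq_of_L2 (WithLp.toLp 2 w), ← EuclideanSpace.norm_eq (WithLp.toLp 2 v)]
    refine (congrArg norm h1.symm).le.trans ((norm_inner_le_norm _ _).trans ?_)
    rw [mul_comm C, mul_assoc]
    gcongr
    exact (matOp A).le_of_opNorm_le hA _
  · intro hA
    refine ContinuousLinearMap.opNorm_le_bound _ hC fun v => ?_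
    -- Testing against `A v` itself gives `‖A v‖² ≤ C ‖A v‖ ‖v‖`.
    have h1 := hA (fun i => matOp A v i) (fun j => v j)
    rw [← inner_matOp, ← PiLp.norm_eq_of_L2, ← EuclideanSpace.norm_eq,
      inner_self_eq_norm_sq_to_K] at h1
    have h2 : ‖(‖matOp A v‖ : ℂ) ^ 2‖ = ‖matOp A v‖ * ‖matOp A v‖ := by
      rw [norm_pow, Complex.norm_real, norm_norm, sq]
    replace h1 := h2.symm.le.trans h1
    rcases (norm_nonneg (matOp A v)).eq_or_lt with h0 | h0
    · rw [← h0]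
      positivity
    · refine le_of_mul_le_mul_left ?_ h0
      linarith

/-- The form of `B` is bounded by `C` relative to the forms of `l` and `m`. -/
def Dominated (C : ℝ) (l m : Matrix (Fin n) (Fin n) ℂ) (B : Matrix (Fin n) (Fin n) h) : Prop :=
  ∀ (w : Fin n → h) (v : Fin n → ℂ), ‖matPair B w v‖ ≤ C * √(matForm l w) * √(matForm m v)

/-- The scalar matrices move onto the test vectors, and the invertible substitutions `w ↦ l^{1/2}
w`, `v ↦ m^{1/2} v` turn the forms of `l` and `m` into plain norms. -/
theorem matNorm_sandwich_le_iff {l m : Matrix (Fin n) (Fin n) ℂ} (hl : l.PosDef) (hm : m.PosDef)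
    (A : Matrix (Fin n) (Fin n) (Ket h)) {C : ℝ} (hC : 0 ≤ C) :
    matNorm (sandwich (CFC.sqrt l)⁻¹ A (CFC.sqrt m)⁻¹) ≤ C ↔ Dominated C l m (ketVec A) := by
  rw [matNorm_le_iff _ hC]
  have hK : ((CFC.sqrt l)⁻¹)ᴴ = (CFC.sqrt l)⁻¹ := by
    rw [conjTranspose_nonsing_inv, conjTranspose_sqrt]
  have c1 : ∀ {E : Type _} [NormedAddCommGroup E] [InnerProductSpace ℂ E]
      {l : Matrix (Fin n) (Fin n) ℂ} (_ : l.PosDef) (w : Fin n → E),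
      matAct (CFC.sqrt l)⁻¹ (matAct (CFC.sqrt l) w) = w := fun hl w => by
    rw [← matAct_mul, nonsing_inv_mul _ (isUnit_det_sqrt hl), matAct_one]
  have c2 : ∀ {E : Type _} [NormedAddCommGroup E] [InnerProductSpace ℂ E]
      {l : Matrix (Fin n) (Fin n) ℂ} (_ : l.PosDef) (w : Fin n → E),
      matAct (CFC.sqrt l) (matAct (CFC.sqrt l)⁻¹ w) = w := fun hl w => by
    rw [← matAct_mul, mul_nonsing_inv _ (isUnit_det_sqrt hl), matAct_one]
  constructor
  · intro H w v
    have h1 := H (matAct (CFC.sqrt l) w) (matAct (CFC.sqrt m) v)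
    rwa [matPair_sandwich, hK, c1 hl w, ← matAct_mul, nonsing_inv_mul _ (isUnit_det_sqrt hm),
      matAct_one, ← matForm_eq_sqrt hl.posSemidef,
      ← matForm_eq_sqrt hm.posSemidef] at h1
  · intro H w v
    have h1 := H (matAct (CFC.sqrt l)⁻¹ w) (matAct (CFC.sqrt m)⁻¹ v)
    rw [matForm_eq_sqrt hl.posSemidef, matForm_eq_sqrt hm.posSemidef, c2 hl, ← matAct_mul (CFC.sqrt m),
      mul_nonsing_inv _ (isUnit_det_sqrt hm), matAct_one] at h1
    rwa [matPair_sandwich, hK]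

theorem Dominated.mono {C : ℝ} (hC : 0 ≤ C) {l l' m m' : Matrix (Fin n) (Fin n) ℂ}
    {B : Matrix (Fin n) (Fin n) h}
    (hB : Dominated C l m B) (hl : ∀ w : Fin n → h, matForm l w ≤ matForm l' w)
    (hm : ∀ v : Fin n → ℂ, matForm m v ≤ matForm m' v) : Dominated C l' m' B := fun w v =>
  (hB w v).trans (by gcongr; exacts [hl w, hm v])

theorem dominated_of_forall_add {C : ℝ} {l m : Matrix (Fin n) (Fin n) ℂ}
    {B : Matrix (Fin n) (Fin n) h}
    (H : ∀ ε : ℝ, 0 < ε → Dominated C (l + (ε : ℂ) • 1) (m + (ε : ℂ) • 1) B) :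
    Dominated C l m B := by
  intro w v
  have h1 : Filter.Tendsto (fun ε : ℝ => C * √(matForm (l + (ε : ℂ) • 1) w) *
      √(matForm (m + (ε : ℂ) • 1) v)) (nhdsWithin 0 (Ioi 0))
      (nhds (C * √(matForm l w) * √(matForm m v))) := by
    simp only [matForm_add, matForm_smul]
    have h2 : Continuous fun ε : ℝ => C * √(matForm l w + ε * matForm 1 w) *
      √(matForm m v + ε * matForm 1 v) := by fun_prop
    have h3 := h2.tendsto 0
    simp only [zero_mul, add_zero] at h3
    exact h3.mono_left nhdsWithin_le_nhds
  refine ge_of_tendsto h1 ?_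
  filter_upwards [self_mem_nhdsWithin] with ε hε using H ε hε w v

/-- A matrix over `|h⟩` acts on families of vectors of any Hilbert space with the same norm. -/
theorem sum_norm_htmul_sq_le {F : Type*} [NormedAddCommGroup F] [InnerProductSpace ℂ F]
    (A : Matrix (Fin n) (Fin n) (Ket h)) (V : Fin n → F) :
    ∑ p, ‖∑ q, (htmul (ketVec A p q) (V q) : HTensor h F)‖ ^ 2 ≤
      matNorm A ^ 2 * ∑ q, ‖V q‖ ^ 2 := by
  -- `G` is the scalar matrix `A* A`.
  set G : Matrix (Fin n) (Fin n) ℂ :=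
    Matrix.of fun q q' => ∑ p, inner ℂ (ketVec A p q) (ketVec A p q') with hG
  have hform : matForm G V = ∑ p, ‖∑ q, (htmul (ketVec A p q) (V q) : HTensor h F)‖ ^ 2 := by
    have h1 : ∑ q, ∑ q', G q q' * inner ℂ (V q) (V q') =
        ∑ p, inner ℂ (∑ q, (htmul (ketVec A p q) (V q) : HTensor h F))
          (∑ q, (htmul (ketVec A p q) (V q) : HTensor h F)) := by
      simp only [hG, of_apply, sum_inner, inner_sum, inner_htmul, Finset.sum_mul]
      rw [Finset.sum_comm_cycle]
      exact Finset.sum_congr rfl fun p _ => Finset.sum_comm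
    rw [matForm, h1, Complex.re_sum]
    exact Finset.sum_congr rfl fun p _ => inner_self_eq_norm_sq (𝕜 := ℂ) _
  have hform' : ∀ v : Fin n → ℂ, matForm G v ≤ matNorm A ^ 2 * ∑ q, ‖v q‖ ^ 2 := by
    intro v
    have h1 : ∑ q, ∑ q', G q q' * inner ℂ (v q) (v q') =
        inner ℂ (matOp A (WithLp.toLp 2 v)) (matOp A (WithLp.toLp 2 v)) := by
      have h2 : ∀ p, matOp A (WithLp.toLp 2 v) p = ∑ q, v q • ketVec A p q := fun p => by
        rw [matOp_apply]
        refine Finset.sum_congr rfl fun q _ => ?_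
        rw [ketVec, Matrix.map_apply, ← map_smul, smul_eq_mul, mul_one]
      rw [PiLp.inner_apply]
      simp only [h2, hG, of_apply, sum_inner, inner_sum, inner_smul_left, inner_smul_right,
        Finset.sum_mul, RCLike.inner_apply, Finset.mul_sum]
      rw [Finset.sum_comm_cycle]
      refine Finset.sum_congr rfl fun p _ => ?_
      rw [Finset.sum_comm]
      exact Finset.sum_congr rfl fun p _ => Finset.sum_congr rfl fun p _ => by ring
    rw [matForm, h1]
    refine (inner_self_eq_norm_sq (𝕜 := ℂ) _).le.trans ?_
    have h3 := (matOp A).le_opNorm (WithLp.toLp 2 v)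
    have h4 := pow_le_pow_left₀ (norm_nonneg _) h3 2
    rwa [mul_pow, EuclideanSpace.norm_sq_eq] at h4
  -- The scalar matrix `‖A‖² - A* A` is positive semidefinite as tested on scalars; through its
  -- square root its form is then nonnegative on families of vectors of any Hilbert space.
  have hpos : (((matNorm A ^ 2 : ℝ) : ℂ) • (1 : Matrix (Fin n) (Fin n) ℂ) +
      ((-1 : ℝ) : ℂ) • G).PosSemidef := by
    refine posSemidef_of_matForm ?_ fun v => ?_
    · refine IsHermitian.ext fun i j => ?_
      simp [hG, Matrix.one_apply, eq_comm, apply_ite]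
    · rw [matForm_add, matForm_smul, matForm_smul, matForm_one]
      linarith [hform' v]
  have h5 := matForm_nonneg hpos V
  rw [matForm_add, matForm_smul, matForm_smul, matForm_one, hform] at h5
  linarith

/-- This is necessity in form language. The pairing becomes `∑ p, ⟪W p, X (∑ q, A p q ⊗ V q)⟫`,
where `W` and `V` are the square roots of `l` and `m` applied to `w i ⊗ e i` and `v j • e j`, so
that their squared norms are the two forms. What remains is contractivity of `X`, Cauchy-Schwarz and
`‖A ⊗ I‖ ≤ ‖A‖`. -/
theorem Dominated.htmul_of_contraction {F : Type*} [NormedAddCommGroup F] [InnerProductSpace ℂ F]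
    {l m : Matrix (Fin n) (Fin n) ℂ} (hl : l.PosDef) (hm : m.PosDef) (e : Fin n → F)
    (X : HTensor h F →L[ℂ] HTensor h F) (hX : ‖X‖ ≤ 1) (P : Matrix (Fin n) (Fin n) (h →L[ℂ] h))
    (hP : ∀ i j u v, inner ℂ u (P i j v) = inner ℂ (htmul u (e i)) (X (htmul v (e j))))
    (A : Matrix (Fin n) (Fin n) (Ket h)) :
    Dominated (matNorm A) (l.hadamard (innerMatrix e)) (m.hadamard (innerMatrix e))
      (ketVec (schurAction P (sandwich (CFC.sqrt l) A (CFC.sqrt m)))) := by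
  intro w v
  rw [matForm_hadamard_innerMatrix, matForm_complex_hadamard_innerMatrix,
    matForm_eq_sqrt hl.posSemidef, matForm_eq_sqrt hm.posSemidef]
  set W := matAct (CFC.sqrt l) fun i => (htmul (w i) (e i) : HTensor h F) with hW
  set V := matAct (CFC.sqrt m) fun j => v j • e j with hV
  have key : matPair (ketVec (schurAction P (sandwich (CFC.sqrt l) A (CFC.sqrt m)))) w v =
      ∑ p, inner ℂ (W p) (X (∑ q, (htmul (ketVec A p q) (V q) : HTensor h F))) := by
    have hsym : ∀ i p, (starRingEnd ℂ) (CFC.sqrt l p i) = CFC.sqrt l i p := fun i p =>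
      congrFun (congrFun (conjTranspose_sqrt l) i) p
    have hLHS : matPair (ketVec (schurAction P (sandwich (CFC.sqrt l) A (CFC.sqrt m)))) w v =
        ∑ i, ∑ j, ∑ p, ∑ q, v j * (CFC.sqrt l i p * CFC.sqrt m q j) *
          inner ℂ (htmul (w i) (e i)) (X (htmul (ketVec A p q) (e j))) := by
      refine Finset.sum_congr rfl fun i _ => Finset.sum_congr rfl fun j _ => ?_
      rw [ketVec_schurAction, of_apply]
      simp only [ketVec, sandwich, Matrix.map_apply, of_apply, _root_.sum_apply,
        _root_.smul_apply, map_sum, map_smul, inner_sum, inner_smul_right, hP, Finset.mul_sum,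
        mul_assoc]
    have hRHS : ∀ p, inner ℂ (W p) (X (∑ q, (htmul (ketVec A p q) (V q) : HTensor h F))) =
        ∑ q, ∑ j, ∑ i, v j * (CFC.sqrt l i p * CFC.sqrt m q j) *
          inner ℂ (htmul (w i) (e i)) (X (htmul (ketVec A p q) (e j))) := by
      intro p
      have h2 : ∀ q, (htmul (ketVec A p q) (V q) : HTensor h F) =
          ∑ j, (CFC.sqrt m q j * v j) • htmul (ketVec A p q) (e j) := fun q => by
        simp only [hV, matAct, htmul, map_sum, map_smul, smul_smul]
      simp only [h2, hW, matAct, map_sum, map_smul, inner_sum, sum_inner, inner_smul_left,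
        inner_smul_right, hsym, Finset.mul_sum]
      refine Finset.sum_congr rfl fun q _ => Finset.sum_congr rfl fun j _ =>
        Finset.sum_congr rfl fun i _ => by ring
    rw [hLHS, Finset.sum_congr rfl fun p _ => hRHS p]
    calc _ = ∑ i, ∑ p, ∑ q, ∑ j, v j * (CFC.sqrt l i p * CFC.sqrt m q j) *
          inner ℂ (htmul (w i) (e i)) (X (htmul (ketVec A p q) (e j))) := by
          refine Finset.sum_congr rfl fun i _ => ?_
          rw [Finset.sum_comm]
          exact Finset.sum_congr rfl fun p _ => Finset.sum_comm
      _ = _ := by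
          rw [Finset.sum_comm]
          refine Finset.sum_congr rfl fun p _ => ?_
          rw [Finset.sum_comm]
          exact Finset.sum_congr rfl fun q _ => Finset.sum_comm
  rw [key]
  have h1 : ∀ p, ‖inner ℂ (W p) (X (∑ q, (htmul (ketVec A p q) (V q) : HTensor h F)))‖ ≤
      ‖W p‖ * ‖∑ q, (htmul (ketVec A p q) (V q) : HTensor h F)‖ := fun p => by
    refine (norm_inner_le_norm _ _).trans ?_
    gcongr
    simpa using X.le_of_opNorm_le hX (∑ q, (htmul (ketVec A p q) (V q) : HTensor h F))
  calc _ ≤ ∑ p, ‖W p‖ * ‖∑ q, (htmul (ketVec A p q) (V q) : HTensor h F)‖ :=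
        (norm_sum_le _ _).trans (Finset.sum_le_sum fun p _ => h1 p)
    _ ≤ √(∑ p, ‖W p‖ ^ 2) * √(∑ p, ‖∑ q, (htmul (ketVec A p q) (V q) : HTensor h F)‖ ^ 2) :=
        Real.sum_mul_le_sqrt_mul_sqrt _ _ _
    _ ≤ √(∑ p, ‖W p‖ ^ 2) * √(matNorm A ^ 2 * ∑ q, ‖V q‖ ^ 2) := by
        gcongr
        exact sum_norm_htmul_sq_le A V
    _ = _ := by
        rw [Real.sqrt_mul (sq_nonneg _), Real.sqrt_sq (matNorm_nonneg A)]
        ring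

end Matrices

/-! ### Products of semigroups along common refinements of step functions -/

section Propagator

variable {α : Type*} {h : Type v} [NormedAddCommGroup h] [InnerProductSpace ℂ h]

/-- The product of the semigroups `S x y` along the common refinement of two lists of
(label, duration) pairs. -/
def propagator (S : α → α → ℝ≥0 → h →L[ℂ] h) :
    List (α × ℝ≥0) → List (α × ℝ≥0) → h →L[ℂ] h
  -- A default: for lists of equal duration, what remains when one is exhausted has duration zero,
  -- and there the semigroups are the identity.
  | [], _ => 1
  | _ :: _, [] => 1
  | p :: L, q :: M =>
    if p.2 ≤ q.2 then S p.1 q.1 p.2 ∘L propagator S L ((q.1, q.2 - p.2) :: M)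
    else S p.1 q.1 q.2 ∘L propagator S ((p.1, p.2 - q.2) :: L) M
termination_by L M => L.length + M.length

variable {S : α → α → ℝ≥0 → h →L[ℂ] h}

theorem propagator_nil_left (M : List (α × ℝ≥0)) : propagator S [] M = 1 := by
  rw [propagator]

theorem propagator_nil_right (L : List (α × ℝ≥0)) : propagator S L [] = 1 := by
  cases L <;> rw [propagator]

theorem propagator_cons_cons (x y : α) (a b : ℝ≥0) (L M : List (α × ℝ≥0)) :
    propagator S ((x, a) :: L) ((y, b) :: M) =
      if a ≤ b then S x y a ∘L propagator S L ((y, b - a) :: M)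
      else S x y b ∘L propagator S ((x, a - b) :: L) M := by
  rw [propagator]

theorem one_comp (A : h →L[ℂ] h) : (1 : h →L[ℂ] h) ∘L A = A := one_mul A

theorem propagator_cons_add (hS : ∀ x y, IsSemigroup (S x y)) (x y : α) (s a b : ℝ≥0)
    (L M : List (α × ℝ≥0)) :
    propagator S ((x, s + a) :: L) ((y, s + b) :: M) =
      S x y s ∘L propagator S ((x, a) :: L) ((y, b) :: M) := by
  rw [propagator_cons_cons, propagator_cons_cons]
  by_cases hab : a ≤ b
  · rw [if_pos hab, if_pos (add_le_add_right hab s), (hS x y).map_add, add_tsub_add_eq_tsub_left,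
      ContinuousLinearMap.comp_assoc]
  · rw [if_neg hab, if_neg (by simpa using hab), (hS x y).map_add, add_tsub_add_eq_tsub_left,
      ContinuousLinearMap.comp_assoc]

theorem propagator_zero_left (hS : ∀ x y, IsSemigroup (S x y)) (x : α) (L M : List (α × ℝ≥0)) :
    propagator S ((x, 0) :: L) M = propagator S L M := by
  cases M with
  | nil => rw [propagator_nil_right, propagator_nil_right]
  | cons q M =>
    obtain ⟨y, b⟩ := q
    rw [propagator_cons_cons, if_pos zero_le, (hS x y).map_zero, tsub_zero, one_comp]

theorem propagator_zero_right (hS : ∀ x y, IsSemigroup (S x y)) (y : α) (L M : List (α × ℝ≥0)) :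
    propagator S L ((y, 0) :: M) = propagator S L M := by
  induction L with
  | nil => rw [propagator_nil_left, propagator_nil_left]
  | cons p L ih =>
    obtain ⟨x, a⟩ := p
    rw [propagator_cons_cons]
    by_cases ha : a ≤ 0
    · obtain rfl := nonpos_iff_eq_zero.1 ha
      rw [if_pos ha, (hS x y).map_zero, tsub_zero, one_comp, ih, propagator_zero_left hS]
    · rw [if_neg ha, (hS x y).map_zero, tsub_zero, one_comp]

theorem propagator_of_duration_eq_zero (hS : ∀ x y, IsSemigroup (S x y)) {L : List (α × ℝ≥0)}
    (hL : duration L = 0) (M : List (α × ℝ≥0)) : propagator S L M = 1 := by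
  induction L with
  | nil => exact propagator_nil_left M
  | cons p L ih =>
    obtain ⟨x, a⟩ := p
    obtain ⟨rfl, h0⟩ := add_eq_zero.1 hL
    rw [propagator_zero_left hS, ih h0]

/-- Equal durations make `L` and `M` end at the same time, so no interval of the common refinement
straddles the cut. This is the source of the cocycle identity. -/
theorem propagator_append (hS : ∀ x y, IsSemigroup (S x y)) (n : ℕ) : ∀ L M L' M' : List (α × ℝ≥0),
    L.length + M.length ≤ n → duration L = duration M →
    propagator S (L ++ L') (M ++ M') = propagator S L M ∘L propagator S L' M' := by
  induction n with
  | zero =>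
    intro L M L' M' hn _
    obtain rfl : L = [] := List.length_eq_zero_iff.1 (by omega)
    obtain rfl : M = [] := List.length_eq_zero_iff.1 (by omega)
    rw [propagator_nil_left, one_comp, List.nil_append, List.nil_append]
  | succ n ih =>
    intro L M L' M' hn hd
    match L, M with
    | [], [] => rw [propagator_nil_left, one_comp, List.nil_append, List.nil_append]
    -- Only blocks of length zero can remain opposite an exhausted list.
    | [], (y, b) :: M =>
      obtain ⟨rfl, h0⟩ := add_eq_zero.1 hd.symm
      rw [List.cons_append, propagator_zero_right hS, propagator_zero_right hS]
      exact ih [] M L' M' (by simp at hn ⊢; omega) h0.symm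
    | (x, a) :: L, [] =>
      obtain ⟨rfl, h0⟩ := add_eq_zero.1 hd
      rw [List.cons_append, propagator_zero_left hS, propagator_zero_left hS]
      exact ih L [] L' M' (by simp at hn ⊢; omega) h0
    | (x, a) :: L, (y, b) :: M =>
      simp only [duration_cons, List.length_cons] at hd hn
      simp only [List.cons_append]
      rw [propagator_cons_cons, propagator_cons_cons]
      by_cases hab : a ≤ b
      · obtain ⟨c, rfl⟩ := exists_add_of_le hab
        rw [if_pos hab, if_pos hab, ← List.cons_append, ih L _ L' M' (by simp; omega),
          ContinuousLinearMap.comp_assoc]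
        rw [add_assoc] at hd
        rw [duration_cons, add_tsub_cancel_left]
        exact add_left_cancel hd
      · obtain ⟨c, rfl⟩ := exists_add_of_le (not_le.1 hab).le
        rw [if_neg hab, if_neg hab, ← List.cons_append, ih _ M L' M' (by simp; omega),
          ContinuousLinearMap.comp_assoc]
        rw [add_assoc] at hd
        rw [duration_cons, add_tsub_cancel_left]
        exact add_left_cancel hd

/-- The list `(x, a) :: L` with the initial segment of duration `s ≤ a` removed. -/
def trimHead (s : ℝ≥0) (x : α) (a : ℝ≥0) (L : List (α × ℝ≥0)) : List (α × ℝ≥0) :=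
  if a ≤ s then L else (x, a - s) :: L

/-- A head used up exactly is dropped instead of being kept with length zero. The propagator does
not see the difference, but the lists become shorter, which drives the induction on their total
length in `SchurContractive.dominated_propagator`. -/
theorem propagator_trimHead (hS : ∀ x y, IsSemigroup (S x y)) (s : ℝ≥0) (x y : α) (a b : ℝ≥0)
    (L M : List (α × ℝ≥0)) (ha : s ≤ a) (hb : s ≤ b) :
    propagator S ((x, a) :: L) ((y, b) :: M) =
      S x y s ∘L propagator S (trimHead s x a L) (trimHead s y b M) := by
  have h1 : ∀ N, propagator S (trimHead s x a L) N = propagator S ((x, a - s) :: L) N := by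
    intro N
    by_cases h : a ≤ s
    · rw [trimHead, if_pos h, tsub_eq_zero_of_le h, propagator_zero_left hS]
    · rw [trimHead, if_neg h]
  have h2 : ∀ N, propagator S N (trimHead s y b M) = propagator S N ((y, b - s) :: M) := by
    intro N
    by_cases h : b ≤ s
    · rw [trimHead, if_pos h, tsub_eq_zero_of_le h, propagator_zero_right hS]
    · rw [trimHead, if_neg h]
  rw [h1, h2, ← propagator_cons_add hS, add_tsub_cancel_of_le ha, add_tsub_cancel_of_le hb]

theorem duration_trimHead (s : ℝ≥0) (x : α) (a : ℝ≥0) (L : List (α × ℝ≥0)) (ha : s ≤ a) :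
    s + duration (trimHead s x a L) = duration ((x, a) :: L) := by
  by_cases h : a ≤ s
  · rw [trimHead, if_pos h, duration_cons, le_antisymm ha h]
  · rw [trimHead, if_neg h, duration_cons, duration_cons, ← add_assoc, add_tsub_cancel_of_le ha]

theorem length_trimHead_le (s : ℝ≥0) (x : α) (a : ℝ≥0) (L : List (α × ℝ≥0)) :
    (trimHead s x a L).length ≤ L.length + 1 := by
  rw [trimHead]
  split <;> simp

variable {k : Type u} [NormedAddCommGroup k] [InnerProductSpace ℂ k]

theorem stepFn_trimHead {T : Set k} (s : ℝ≥0) (x : T) (a : ℝ≥0) (L : List (T × ℝ≥0))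
    (ha : s ≤ a) :
    stepFn (listVal ((x, a) :: L)) = stepFn (((x : k), s) :: listVal (trimHead s x a L)) := by
  have h1 : stepFn (listVal ((x, a) :: L)) =
      stepFn (((x : k), s) :: listVal ((x, a - s) :: L)) := by
    change stepFn (((x : k), a) :: listVal L) =
      stepFn (((x : k), s) :: ((x : k), a - s) :: listVal L)
    rw [← stepFn_cons_add, add_tsub_cancel_of_le ha]
  rw [h1]
  by_cases h : a ≤ s
  · rw [trimHead, if_pos h, tsub_eq_zero_of_le h, stepFn_cons, stepFn_cons]
    exact congrArg (fun z => constOn (x : k) s + rightShift k s z)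
      (stepFn_cons_zero (x : k) (listVal L))
  · rw [trimHead, if_neg h]

theorem stepFn_of_duration_eq_zero {L : List (k × ℝ≥0)} (hL : duration L = 0) : stepFn L = 0 := by
  induction L with
  | nil => rfl
  | cons p L ih =>
    obtain ⟨x, a⟩ := p
    obtain ⟨rfl, h0⟩ := add_eq_zero.1 hL
    rw [stepFn_cons_zero, ih h0]

end Propagator

/-! ### Iteration of the Schur inequality along step functions -/

section Domination

variable {k : Type u} [NormedAddCommGroup k] [InnerProductSpace ℂ k] [CompleteSpace k]
  {h : Type v} [NormedAddCommGroup h] [InnerProductSpace ℂ h]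
  {T : Set k} {S : T → T → ℝ≥0 → h →L[ℂ] h}

theorem gram_eq_innerMatrix {n : ℕ} (x : Fin n → k) (t : ℝ≥0) :
    gram x t = innerMatrix fun i => expVec (constOn (x i) t) := by
  ext i j
  rw [gram, innerMatrix, of_apply, of_apply, inner_expVec, chi_constOn, neg_mul]

theorem expVec_ne_zero {H : Type*} [NormedAddCommGroup H] [InnerProductSpace ℂ H] (f : H) :
    expVec f ≠ 0 := fun h0 => by
  have := inner_expVec_self f
  rw [h0, inner_zero_left] at this
  exact zero_ne_one this

/-- The norm inequality of the characterisation, for a family `S`. -/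
def SchurContractive (S : T → T → ℝ≥0 → h →L[ℂ] h) : Prop :=
  ∀ (n : ℕ), 1 ≤ n → ∀ (lam mu : Matrix (Fin n) (Fin n) ℂ), lam.PosDef → mu.PosDef →
    ∀ (x : Fin n → T) (t : ℝ≥0) (A : Matrix (Fin n) (Fin n) (Ket h)),
      matNorm (sandwich
          (CFC.sqrt (lam.hadamard (gram (fun i => (x i : k)) t)))⁻¹
          (schurAction (Matrix.of fun i j => S (x i) (x j) t)
            (sandwich (CFC.sqrt lam) A (CFC.sqrt mu)))
          (CFC.sqrt (mu.hadamard (gram (fun i => (x i : k)) t)))⁻¹) ≤ matNorm A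

theorem posDef_hadamard_gram {n : ℕ} {l : Matrix (Fin n) (Fin n) ℂ} (hl : l.PosDef)
    (x : Fin n → k) (t : ℝ≥0) : (l.hadamard (gram x t)).PosDef := by
  rw [gram_eq_innerMatrix]
  exact posDef_hadamard_innerMatrix hl fun i => expVec_ne_zero _

/-- Apply the inequality to `A = l^{-1/2} B m^{-1/2}`, whose norm is at most `1` by domination; its
inner square roots then cancel. -/
theorem SchurContractive.dominated_of_posDef (H : SchurContractive S) {n : ℕ} (hn : 1 ≤ n)
    {l m : Matrix (Fin n) (Fin n) ℂ} (hl : l.PosDef) (hm : m.PosDef) (x : Fin n → T) (t : ℝ≥0)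
    {B : Matrix (Fin n) (Fin n) h} (hB : Dominated 1 l m B) :
    Dominated 1 (l.hadamard (gram (fun i => (x i : k)) t))
      (m.hadamard (gram (fun i => (x i : k)) t))
      (Matrix.of fun i j => S (x i) (x j) t (B i j)) := by
  set A := sandwich (CFC.sqrt l)⁻¹ (vecKet B) (CFC.sqrt m)⁻¹ with hA
  have h1 : matNorm A ≤ 1 := (matNorm_sandwich_le_iff hl hm _ zero_le_one).2
    (by rwa [ketVec_vecKet])
  have h2 : sandwich (CFC.sqrt l) A (CFC.sqrt m) = vecKet B := by
    rw [hA, sandwich_sandwich, mul_nonsing_inv _ (isUnit_det_sqrt hl),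
      nonsing_inv_mul _ (isUnit_det_sqrt hm), sandwich_one]
  have h3 := (H n hn l m hl hm x t A).trans h1
  rw [h2, matNorm_sandwich_le_iff (posDef_hadamard_gram hl _ _) (posDef_hadamard_gram hm _ _) _
    zero_le_one, ketVec_schurAction, ketVec_vecKet] at h3
  exact h3

/-- Perturb `l` and `m` by `ε • 1` and let `ε` tend to `0`. Since `chi x x = 0`, the Gram matrix has
diagonal entries `1`, so the perturbation passes unchanged through the Schur product. -/
theorem SchurContractive.dominated (H : SchurContractive S) {n : ℕ} (hn : 1 ≤ n)
    {l m : Matrix (Fin n) (Fin n) ℂ} (hl : l.PosSemidef) (hm : m.PosSemidef) (x : Fin n → T)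
    (t : ℝ≥0) {B : Matrix (Fin n) (Fin n) h} (hB : Dominated 1 l m B) :
    Dominated 1 (l.hadamard (gram (fun i => (x i : k)) t))
      (m.hadamard (gram (fun i => (x i : k)) t))
      (Matrix.of fun i j => S (x i) (x j) t (B i j)) := by
  refine dominated_of_forall_add fun ε hε => ?_
  have hε1 : ((ε : ℂ) • (1 : Matrix (Fin n) (Fin n) ℂ)).PosDef :=
    PosDef.one.smul (by exact_mod_cast hε)
  have hform : ∀ {E : Type v} [NormedAddCommGroup E] [InnerProductSpace ℂ E]
      (l : Matrix (Fin n) (Fin n) ℂ) (w : Fin n → E),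
      matForm l w ≤ matForm (l + (ε : ℂ) • 1) w := fun l w => by
    rw [matForm_add, matForm_smul, matForm_one]
    have : 0 ≤ ∑ i, ‖w i‖ ^ 2 := by positivity
    nlinarith
  have hform' : ∀ (l : Matrix (Fin n) (Fin n) ℂ) (w : Fin n → ℂ),
      matForm l w ≤ matForm (l + (ε : ℂ) • 1) w := fun l w => by
    rw [matForm_add, matForm_smul, matForm_one]
    have : 0 ≤ ∑ i, ‖w i‖ ^ 2 := by positivity
    nlinarith
  have h1 := H.dominated_of_posDef hn (PosDef.posSemidef_add hl hε1) (PosDef.posSemidef_add hm hε1) x t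
    (hB.mono zero_le_one (hform l) (hform' m))
  have hG : ∀ l : Matrix (Fin n) (Fin n) ℂ,
      (l + (ε : ℂ) • 1).hadamard (gram (fun i => (x i : k)) t) =
        l.hadamard (gram (fun i => (x i : k)) t) + (ε : ℂ) • 1 := by
    intro l
    ext i j
    simp only [hadamard_apply, Matrix.add_apply, Matrix.smul_apply, Matrix.one_apply, gram,
      of_apply]
    split_ifs with hij
    · subst hij
      simp [chi_self]
    · simp
  rwa [hG, hG] at h1

omit [CompleteSpace k] in
theorem dominated_propagator_of_duration_eq_zero (hS : ∀ x y, IsSemigroup (S x y)) {n : ℕ}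
    {L : Fin n → List (T × ℝ≥0)} (hL : ∀ i, duration (L i) = 0)
    {l m : Matrix (Fin n) (Fin n) ℂ} {B : Matrix (Fin n) (Fin n) h} (hB : Dominated 1 l m B) :
    Dominated 1 (l.hadamard (innerMatrix fun i => expVec (stepFn (listVal (L i)))))
      (m.hadamard (innerMatrix fun i => expVec (stepFn (listVal (L i)))))
      (Matrix.of fun i j => propagator S (L i) (L j) (B i j)) := by
  have hG : ∀ l : Matrix (Fin n) (Fin n) ℂ,
      l.hadamard (innerMatrix fun i => expVec (stepFn (listVal (L i)))) = l := by
    intro l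
    ext i j
    have h0 : ∀ i, stepFn (listVal (L i)) = 0 := fun i =>
      stepFn_of_duration_eq_zero ((duration_listVal _).trans (hL i))
    rw [hadamard_apply, innerMatrix, of_apply, h0, h0, inner_expVec_self, mul_one]
  have hB' : (Matrix.of fun i j => propagator S (L i) (L j) (B i j)) = B := by
    ext1 i j
    rw [of_apply, propagator_of_duration_eq_zero hS (hL i)]
    rfl
  rwa [hG, hG, hB']

/-- Up to the end of the shortest head block, all the step functions are constant. Removing that
initial interval leaves tails covered by induction; the semigroups on it compose on the left of the
propagators of the tails, and its Gram matrix multiplies theirs. -/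
theorem SchurContractive.dominated_propagator (H : SchurContractive S)
    (hS : ∀ x y, IsSemigroup (S x y)) {n : ℕ} (hn : 1 ≤ n) (N : ℕ) :
    ∀ (t : ℝ≥0) (L : Fin n → List (T × ℝ≥0)), ∑ i, (L i).length ≤ N →
      (∀ i, duration (L i) = t) → ∀ {l m : Matrix (Fin n) (Fin n) ℂ}, l.PosSemidef →
      m.PosSemidef → ∀ {B : Matrix (Fin n) (Fin n) h}, Dominated 1 l m B →
      Dominated 1 (l.hadamard (innerMatrix fun i => expVec (stepFn (listVal (L i)))))
        (m.hadamard (innerMatrix fun i => expVec (stepFn (listVal (L i)))))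
        (Matrix.of fun i j => propagator S (L i) (L j) (B i j)) := by
  induction N with
  | zero =>
    intro t L hN hd l m hl hm B hB
    refine dominated_propagator_of_duration_eq_zero hS (fun i => ?_) hB
    have h0 := (Finset.sum_eq_zero_iff.1 (Nat.le_zero.1 hN)) i (Finset.mem_univ i)
    rw [List.length_eq_zero_iff.1 h0, duration_nil]
  | succ N ih =>
    intro t L hN hd l m hl hm B hB
    by_cases hnil : ∃ i, L i = []
    · obtain ⟨i, hi⟩ := hnil
      have ht : t = 0 := by rw [← hd i, hi, duration_nil]
      exact dominated_propagator_of_duration_eq_zero hS (fun i => (hd i).trans ht) hB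
    · push Not at hnil
      have hne : ∀ i, ∃ (x : T) (a : ℝ≥0) (R : List (T × ℝ≥0)), L i = (x, a) :: R := fun i => by
        obtain ⟨p, R, hR⟩ := List.exists_cons_of_ne_nil (hnil i)
        exact ⟨p.1, p.2, R, hR⟩
      choose x a R hR using hne
      -- The list at the minimising index loses its head entirely and no other list grows, so the
      -- total length decreases.
      obtain ⟨i₀, -, hi₀⟩ := Finset.exists_min_image Finset.univ a ⟨⟨0, hn⟩, Finset.mem_univ _⟩
      have hmin : ∀ i, a i₀ ≤ a i := fun i => hi₀ i (Finset.mem_univ i)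
      have hd' : ∀ i, a i₀ + duration (trimHead (a i₀) (x i) (a i) (R i)) = t := fun i => by
        rw [duration_trimHead _ _ _ _ (hmin i), ← hR, hd]
      have h1 := ih (duration (trimHead (a i₀) (x i₀) (a i₀) (R i₀)))
        (fun i => trimHead (a i₀) (x i) (a i) (R i)) ?_
        (fun i => add_left_cancel ((hd' i).trans (hd' i₀).symm)) hl hm hB
      · have h2 := H.dominated hn (hl.hadamard (posSemidef_innerMatrix _))
          (hm.hadamard (posSemidef_innerMatrix _)) x (a i₀) h1
        have hG : ∀ l : Matrix (Fin n) (Fin n) ℂ, (l.hadamard (innerMatrix fun i =>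
            expVec (stepFn (listVal (trimHead (a i₀) (x i) (a i) (R i)))))).hadamard
              (gram (fun i => (x i : k)) (a i₀)) =
            l.hadamard (innerMatrix fun i => expVec (stepFn (listVal (L i)))) := by
          intro l
          ext i j
          simp only [hadamard_apply, innerMatrix, of_apply, gram, inner_expVec, hR]
          rw [stepFn_trimHead _ _ _ _ (hmin i), stepFn_trimHead _ _ _ _ (hmin j), chi_stepFn_cons,
            mul_assoc, ← Complex.exp_add]
          congr 2
          ring
        rw [hG, hG] at h2
        convert h2 using 2
        funext i j
        rw [hR i, hR j, propagator_trimHead hS _ _ _ _ _ _ _ (hmin i) (hmin j)]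
        rfl
      · refine Nat.le_of_lt_succ (lt_of_lt_of_le (Finset.sum_lt_sum (fun i _ => ?_)
          ⟨i₀, Finset.mem_univ _, ?_⟩) hN)
        · rw [hR i]
          exact length_trimHead_le _ _ _ _
        · rw [hR i₀, trimHead, if_pos le_rfl]
          simp

theorem matForm_innerMatrix {n : ℕ} {E : Type*} [NormedAddCommGroup E] [InnerProductSpace ℂ E]
    (e : Fin n → E) (v : Fin n → ℂ) : matForm (innerMatrix e) v = ‖∑ i, v i • e i‖ ^ 2 := by
  have h1 : ∑ i, ∑ j, innerMatrix e i j * inner ℂ (v i) (v j) =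
      inner ℂ (∑ i, v i • e i) (∑ i, v i • e i) := by
    simp only [innerMatrix, of_apply, sum_inner, inner_sum, inner_smul_left, inner_smul_right,
      RCLike.inner_apply]
    rw [Finset.sum_comm]
    refine Finset.sum_congr rfl fun i _ => ?_
    rw [Finset.mul_sum]
    exact Finset.sum_congr rfl fun j _ => by ring
  rw [matForm, h1]
  exact inner_self_eq_norm_sq (𝕜 := ℂ) _

theorem matForm_ones {n : ℕ} {E : Type*} [NormedAddCommGroup E] [InnerProductSpace ℂ E]
    (w : Fin n → E) : matForm (Matrix.of fun _ _ => 1) w = ‖∑ i, w i‖ ^ 2 := by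
  have h1 : ∑ i, ∑ j, (Matrix.of fun _ _ : Fin n => (1 : ℂ)) i j * inner ℂ (w i) (w j) =
      inner ℂ (∑ i, w i) (∑ i, w i) := by
    simp only [of_apply, sum_inner, inner_sum, one_mul]
    rw [Finset.sum_comm]
  rw [matForm, h1]
  exact inner_self_eq_norm_sq (𝕜 := ℂ) _

/-- The propagated domination is evaluated at `w i = c i • u i` and `v = d`. The all-ones matrix
then produces the first norm and the Gram matrix of `u` the second. -/
theorem SchurContractive.norm_sum_propagator_le (H : SchurContractive S)
    (hS : ∀ x y, IsSemigroup (S x y)) {n : ℕ} (t : ℝ≥0) (L : Fin n → List (T × ℝ≥0))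
    (hL : ∀ i, duration (listVal (L i)) = t) (u : Fin n → h) (c d : Fin n → ℂ) :
    ‖∑ i, ∑ j, (starRingEnd ℂ) (c i) * d j * inner ℂ (u i) (propagator S (L i) (L j) (u j))‖ ≤
      ‖∑ i, c i • (htmul (u i) (expVec (stepAt _ (hL i))) : HTensor h _)‖ *
      ‖∑ i, d i • (htmul (u i) (expVec (stepAt _ (hL i))) : HTensor h _)‖ := by
  rcases Nat.eq_zero_or_pos n with rfl | hn
  · simp
  have hones : (Matrix.of fun _ _ : Fin n => (1 : ℂ)).PosSemidef := by
    have := posSemidef_innerMatrix fun _ : Fin n => (1 : ℂ)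
    simpa [innerMatrix] using this
  -- The entries do not depend on the row, so the pairing is `⟪∑ w i, ∑ v j • u j⟫`, and domination
  -- is Cauchy-Schwarz.
  have hB : Dominated 1 (Matrix.of fun _ _ : Fin n => (1 : ℂ)) (innerMatrix u)
      (Matrix.of fun _ j => u j) := by
    intro w v
    rw [matForm_innerMatrix, matForm_ones, Real.sqrt_sq (norm_nonneg _),
      Real.sqrt_sq (norm_nonneg _), one_mul]
    refine le_trans (le_of_eq ?_) (norm_inner_le_norm (𝕜 := ℂ) (∑ i, w i) (∑ i, v i • u i))
    simp only [matPair, of_apply, sum_inner, inner_sum, inner_smul_right, Finset.mul_sum]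
    rw [Finset.sum_comm]
  have hin : ∀ i j, inner ℂ (expVec (stepFn (listVal (L i)))) (expVec (stepFn (listVal (L j)))) =
      inner ℂ (expVec (stepAt _ (hL i))) (expVec (stepAt _ (hL j))) := fun i j => by
    rw [inner_expVec, inner_expVec, chi_stepAt]
  have h1 := H.dominated_propagator hS hn _ t L le_rfl
    (fun i => (duration_listVal _).symm.trans (hL i)) hones (posSemidef_innerMatrix u) hB
    (fun i => c i • u i) d
  have hE : (innerMatrix fun i => expVec (stepFn (listVal (L i)))) =
      innerMatrix fun i => expVec (stepAt _ (hL i)) := by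
    ext i j
    exact hin i j
  have h2 : (innerMatrix u).hadamard (innerMatrix fun i => expVec (stepAt _ (hL i))) =
      innerMatrix fun i => (htmul (u i) (expVec (stepAt _ (hL i))) : HTensor h _) := by
    ext i j
    exact (inner_htmul (u i) (u j) (expVec (stepAt _ (hL i))) (expVec (stepAt _ (hL j)))).symm
  rw [hE, h2, matForm_innerMatrix, matForm_hadamard_innerMatrix, matForm_ones,
    Real.sqrt_sq (norm_nonneg _), Real.sqrt_sq (norm_nonneg _), one_mul] at h1
  refine le_trans (le_of_eq (congrArg norm ?_)) (h1.trans (le_of_eq ?_))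
  · simp only [matPair, of_apply, inner_smul_left]
    exact Finset.sum_congr rfl fun i _ => Finset.sum_congr rfl fun j _ => by ring
  · simp only [htmul, map_smul, _root_.smul_apply]

end Domination

/-! ### From bounded kernels on total families to operators -/

section Kernel

theorem denseRange_linearCombination {ι E : Type*} [NormedAddCommGroup E] [InnerProductSpace ℂ E]
    {b : ι → E} (hb : (Submodule.span ℂ (range b)).topologicalClosure = ⊤) :
    DenseRange (Finsupp.linearCombination ℂ b) := by
  rw [← Finsupp.range_linearCombination, ← Submodule.dense_iff_topologicalClosure_eq_top] at hb
  exact hb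

theorem eq_of_forall_inner_total {ι E : Type*} [NormedAddCommGroup E] [InnerProductSpace ℂ E]
    {b : ι → E} (hb : (Submodule.span ℂ (range b)).topologicalClosure = ⊤) {y z : E}
    (h : ∀ i, inner ℂ (b i) y = inner ℂ (b i) z) : y = z := by
  refine (Submodule.dense_iff_topologicalClosure_eq_top.2 hb).eq_of_inner_right (𝕜 := ℂ)
    fun x hx => ?_
  induction hx using Submodule.span_induction with
  | mem x hx => obtain ⟨i, rfl⟩ := hx; exact h i
  | zero => simp
  | add x y _ _ hx hy => rw [inner_add_left, inner_add_left, hx, hy]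
  | smul a x _ hx => rw [inner_smul_left, inner_smul_left, hx]

theorem clm_ext_total {ι E F : Type*} [NormedAddCommGroup E] [InnerProductSpace ℂ E]
    [NormedAddCommGroup F] [InnerProductSpace ℂ F]
    {b : ι → E} (hb : (Submodule.span ℂ (range b)).topologicalClosure = ⊤) {X Y : E →L[ℂ] F}
    (h : ∀ i, X (b i) = Y (b i)) : X = Y := by
  refine ContinuousLinearMap.ext_on (Submodule.dense_iff_topologicalClosure_eq_top.2 hb) ?_
  rintro _ ⟨i, rfl⟩
  exact h i

theorem total_image {ι E F : Type*} [NormedAddCommGroup E] [InnerProductSpace ℂ E]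
    [NormedAddCommGroup F] [InnerProductSpace ℂ F]
    {b : ι → E} (hb : (Submodule.span ℂ (range b)).topologicalClosure = ⊤) (U : E →L[ℂ] F)
    (hU : DenseRange U) :
    (Submodule.span ℂ (range fun i => U (b i))).topologicalClosure = ⊤ := by
  have := hU.topologicalClosure_map_submodule hb
  rwa [Submodule.map_span, ← range_comp] at this

/-- A bounded kernel on a total family is the kernel of a bounded operator. -/
theorem exists_clm_of_kernel {ι E : Type*} [NormedAddCommGroup E] [InnerProductSpace ℂ E]
    [CompleteSpace E] {b : ι → E} (hb : (Submodule.span ℂ (range b)).topologicalClosure = ⊤)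
    (K : ι → ι → ℂ)
    (hK : ∀ c d : ι →₀ ℂ,
      ‖c.sum fun i ci => (starRingEnd ℂ) ci * d.sum fun j dj => dj * K i j‖ ≤
        ‖Finsupp.linearCombination ℂ b c‖ * ‖Finsupp.linearCombination ℂ b d‖) :
    ∃ Z : E →L[ℂ] E, ‖Z‖ ≤ 1 ∧ ∀ i j, inner ℂ (b i) (Z (b j)) = K i j := by
  have hdense := denseRange_linearCombination hb
  have hz : ∀ d : ι →₀ ℂ, ∃ z : E, ‖z‖ ≤ ‖Finsupp.linearCombination ℂ b d‖ ∧
      ∀ i, inner ℂ (b i) z = d.sum fun j dj => dj * K i j := by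
    intro d
    -- Conjugating the form makes it linear in `c`, as the Riesz representation requires.
    set φ : (ι →₀ ℂ) →ₗ[ℂ] ℂ := Finsupp.linearCombination ℂ fun i =>
      (starRingEnd ℂ) (d.sum fun j dj => dj * K i j) with hφ
    have hb' : ∀ c, ‖φ c‖ ≤ ‖Finsupp.linearCombination ℂ b d‖ *
        ‖Finsupp.linearCombination ℂ b c‖ := by
      intro c
      rw [mul_comm]
      refine le_trans (le_of_eq ?_) (hK c d)
      rw [← RCLike.norm_conj, hφ, Finsupp.linearCombination_apply, Finsupp.sum, Finsupp.sum, map_sum]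
      simp
    refine ⟨(InnerProductSpace.toDual ℂ E).symm (φ.extendOfNorm (Finsupp.linearCombination ℂ b)),
      ?_, fun i => ?_⟩
    · rw [LinearIsometryEquiv.norm_map]
      exact LinearMap.opNorm_extendOfNorm_le hdense (norm_nonneg _) hb'
    · rw [← inner_conj_symm, InnerProductSpace.toDual_symm_apply]
      have := LinearMap.extendOfNorm_eq (f := φ) hdense ⟨_, hb'⟩ (Finsupp.single i 1)
      rw [Finsupp.linearCombination_single, one_smul] at this
      rw [this, hφ, Finsupp.linearCombination_single, one_smul, Complex.conj_conj]
  choose z hz1 hz2 using hz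
  -- The Riesz vectors are determined by their inner products with a total family, whence linearity
  -- in `d`.
  let Z₀ : (ι →₀ ℂ) →ₗ[ℂ] E :=
    { toFun := z
      map_add' := fun d d' => eq_of_forall_inner_total hb fun i => by
        rw [inner_add_right, hz2, hz2, hz2]
        exact Finsupp.sum_add_index' (by simp) (fun j a b => add_mul _ _ _)
      map_smul' := fun a d => eq_of_forall_inner_total hb fun i => by
        rw [RingHom.id_apply, inner_smul_right, hz2, hz2, Finsupp.sum_smul_index (by simp),
          Finsupp.mul_sum]
        exact Finsupp.sum_congr fun j _ => by ring }
  have hZ₀ : ∀ d, ‖Z₀ d‖ ≤ 1 * ‖Finsupp.linearCombination ℂ b d‖ := fun d => by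
    rw [one_mul]; exact hz1 d
  refine ⟨Z₀.extendOfNorm (Finsupp.linearCombination ℂ b),
    LinearMap.opNorm_extendOfNorm_le hdense zero_le_one hZ₀, fun i j => ?_⟩
  have := LinearMap.extendOfNorm_eq (f := Z₀) hdense ⟨1, hZ₀⟩ (Finsupp.single j 1)
  rw [Finsupp.linearCombination_single, one_smul] at this
  rw [this]
  refine (hz2 _ i).trans ?_
  simp

end Kernel

/-! ### The contractions on `h ⊗ ℱ_{[0,t[}` -/

section Operators

variable {k : Type u} [NormedAddCommGroup k] [InnerProductSpace ℂ k] [CompleteSpace k]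
  {h : Type v} [NormedAddCommGroup h] [InnerProductSpace ℂ h] [CompleteSpace h]
  {T : Set k} {S : T → T → ℝ≥0 → h →L[ℂ] h}

omit [CompleteSpace h] in
theorem total_htmul_stepAt (hT0 : (0 : k) ∈ T)
    (hT : (Submodule.span ℂ T).topologicalClosure = ⊤) (t : ℝ≥0) :
    (Submodule.span ℂ (range fun p : h × {L : List (T × ℝ≥0) // duration (listVal L) = t} =>
      (htmul p.1 (expVec (stepAt (listVal p.2.1) p.2.2)) :
        HTensor h (Fock (L2 k (Ico 0 (t : ℝ))))))).topologicalClosure = ⊤ := by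
  have := dense_span_htmul (a := fun u : h => u)
    (b := fun L : {L : List (T × ℝ≥0) // duration (listVal L) = t} =>
      expVec (stepAt (listVal L.1) L.2)) dense_span_id (dense_span_expVec_stepAt hT0 hT t)
  exact this

omit [CompleteSpace h] in
-- The kernel is indexed by lists, not by functions. That different lists for the same step function
-- give compatible values needs no separate argument: the norm bound of the kernel already forces
-- every linear relation among the vectors to be respected.
theorem SchurContractive.exists_contraction (H : SchurContractive S)
    (hS : ∀ x y, IsSemigroup (S x y)) (hT0 : (0 : k) ∈ T)
    (hT : (Submodule.span ℂ T).topologicalClosure = ⊤) (t : ℝ≥0) :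
    ∃ Z : HTensor h (Fock (L2 k (Ico 0 (t : ℝ)))) →L[ℂ] HTensor h (Fock (L2 k (Ico 0 (t : ℝ)))),
      ‖Z‖ ≤ 1 ∧ ∀ (L M : List (T × ℝ≥0)) (hL : duration (listVal L) = t)
        (hM : duration (listVal M) = t) (u v : h),
        inner ℂ (htmul u (expVec (stepAt _ hL))) (Z (htmul v (expVec (stepAt _ hM)))) =
          inner ℂ u (propagator S L M v) := by
  classical
  suffices hK : _ by
    obtain ⟨Z, hZ1, hZ⟩ := exists_clm_of_kernel (total_htmul_stepAt (h := h) hT0 hT t)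
      (fun p q => inner ℂ p.1 (propagator S p.2.1 q.2.1 q.1)) hK
    exact ⟨Z, hZ1, fun L M hL hM u v => hZ (u, ⟨L, hL⟩) (v, ⟨M, hM⟩)⟩
  · intro c d
    -- The estimate uses one family of vectors for both sides, so both combinations are written over
    -- the union of their supports.
    set s := c.support ∪ d.support with hs
    have e := s.equivFin.symm
    have h1 := H.norm_sum_propagator_le hS t (fun i => (e i).1.2.1) (fun i => (e i).1.2.2)
      (fun i => (e i).1.1) (fun i => c (e i)) (fun i => d (e i))
    have hsum : ∀ {M : Type _} [AddCommMonoid M]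
        (f : h × {L : List (T × ℝ≥0) // duration (listVal L) = t} → M),
        ∑ i, f (e i) = ∑ p ∈ s, f p := fun f => by
      rw [e.sum_comp (fun p : s => f p), Finset.sum_coe_sort s f]
    have hsum' : ∀ {M : Type _} [AddCommMonoid M]
        (f : h × {L : List (T × ℝ≥0) // duration (listVal L) = t} → M),
        ∑ i, f (e i) = ∑ p ∈ s, f p := fun f => by
      rw [e.sum_comp (fun p : s => f p), Finset.sum_coe_sort s f]
    rw [Finsupp.linearCombination_apply, Finsupp.linearCombination_apply,
      Finsupp.sum_of_support_subset c Finset.subset_union_left _ (by simp),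
      Finsupp.sum_of_support_subset d Finset.subset_union_right _ (by simp),
      Finsupp.sum_of_support_subset c Finset.subset_union_left _ (by simp),
      ← hs, ← hsum, ← hsum', ← hsum']
    refine le_trans (le_of_eq (congrArg norm ?_)) h1
    refine Finset.sum_congr rfl fun i _ => ?_
    rw [Finsupp.sum_of_support_subset d Finset.subset_union_right _ (by simp), ← hs, ← hsum,
      Finset.mul_sum]
    exact Finset.sum_congr rfl fun j _ => by ring

end Operators

/-! ### Ampliations and their matrix elements -/

section Ampliation

variable {E : Type u} {F : Type v} [NormedAddCommGroup E] [InnerProductSpace ℂ E]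
  [NormedAddCommGroup F] [InnerProductSpace ℂ F]

theorem total_htmul : (Submodule.span ℂ
    (range fun p : E × F => (htmul p.1 p.2 : HTensor E F))).topologicalClosure = ⊤ := by
  have := dense_span_htmul (a := fun x : E => x) (b := fun y : F => y) dense_span_id dense_span_id
  exact this

theorem total_htmul_expVec {H : Type*} [NormedAddCommGroup H] [InnerProductSpace ℂ H] :
    (Submodule.span ℂ (range fun p : E × H =>
      (htmul p.1 (expVec p.2) : HTensor E (Fock H)))).topologicalClosure = ⊤ := by
  have := dense_span_htmul (a := fun x : E => x) (b := fun f : H => expVec f) dense_span_id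
    dense_span_expVec
  exact this

theorem clm_one_apply (x : E) : (1 : E →L[ℂ] E) x = x := rfl

theorem ampl_one : ampl F (1 : E →L[ℂ] E) = 1 :=
  clm_ext_total total_htmul fun _ => ampl_htmul _ _ _

theorem norm_ampl_le (X : E →L[ℂ] E) : ‖ampl F X‖ ≤ ‖X‖ := by
  refine ContinuousLinearMap.opNorm_le_bound _ (norm_nonneg _) fun z => ?_
  refine HTensor.denseRange_ofAlg.induction_on z (isClosed_le (by fun_prop) (by fun_prop)) fun z => ?_
  have h1 : ampl F X (HTensor.ofAlg z) = HTensor.ofAlg (X.rTensor F z) :=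
    ContinuousLinearMap.completion_apply_coe (X.rTensor F) z
  rw [h1, LinearIsometry.norm_map, LinearIsometry.norm_map]
  exact ContinuousLinearMap.le_of_opNorm_le _ (ContinuousLinearMap.norm_rTensor_le ..) z

/-- The vector `z` is arbitrary: this is what allows an ampliation to be moved off a vector that is
not a simple tensor in the splitting at hand. -/
theorem inner_htmul_ampl [CompleteSpace E] (X : E →L[ℂ] E) (x : E) (y : F) (z : HTensor E F) :
    inner ℂ (htmul x y) (ampl F X z) = inner ℂ (htmul (X.adjoint x) y) z := by
  have h1 : (innerSL ℂ (htmul x y : HTensor E F)) ∘L ampl F X =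
      innerSL ℂ (htmul (X.adjoint x) y : HTensor E F) := by
    refine clm_ext_total total_htmul fun p => ?_
    rw [ContinuousLinearMap.comp_apply, ampl_htmul, innerSL_apply_apply, innerSL_apply_apply,
      inner_htmul, inner_htmul, ContinuousLinearMap.adjoint_inner_left]
  exact DFunLike.congr_fun h1 z

variable (E) in
/-- The operator `x ↦ x ⊗ y`. -/
def tensorRight (y : F) : E →L[ℂ] HTensor E F := htmulL.flip y

end Ampliation

/-! ### Unitarity of the exponential factorisation -/

section FactorUnitary

variable {h : Type v} [NormedAddCommGroup h] [InnerProductSpace ℂ h]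
  {H H₁ H₂ : Type u}
  [NormedAddCommGroup H] [InnerProductSpace ℂ H]
  [NormedAddCommGroup H₁] [InnerProductSpace ℂ H₁]
  [NormedAddCommGroup H₂] [InnerProductSpace ℂ H₂]

/-- On the total family of product vectors, `factor` preserves inner products by additivity of `chi`
over orthogonal summands. -/
theorem factor_adjoint_comp_factor {i₁ : H₁ →ₗᵢ[ℂ] H} {i₂ : H₂ →ₗᵢ[ℂ] H}
    (hi : ∀ f g, inner ℂ (i₁ f) (i₂ g) = 0) :
    (factor h i₁ i₂).adjoint ∘L factor h i₁ i₂ = 1 := by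
  refine clm_ext_total (dense_span_factor_source (h := h)) fun p =>
    eq_of_forall_inner_total (dense_span_factor_source (h := h)) fun q => ?_
  rw [ContinuousLinearMap.comp_apply, ContinuousLinearMap.adjoint_inner_right, factor_apply _ _ hi,
    factor_apply _ _ hi, clm_one_apply, inner_htmul, inner_htmul, inner_htmul, inner_expVec,
    inner_expVec, inner_expVec, mul_assoc, ← Complex.exp_add, chi_add_of_orthogonal i₁ i₂ hi,
    neg_add]

theorem factor_adjoint_apply {i₁ : H₁ →ₗᵢ[ℂ] H} {i₂ : H₂ →ₗᵢ[ℂ] H}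
    (hi : ∀ f g, inner ℂ (i₁ f) (i₂ g) = 0) (u : h) (f : H₁) (g : H₂) :
    (factor h i₁ i₂).adjoint (htmul u (expVec (i₁ f + i₂ g))) =
      htmul (htmul u (expVec f)) (expVec g) := by
  rw [← factor_apply _ _ hi]
  exact DFunLike.congr_fun (factor_adjoint_comp_factor hi) _

theorem norm_factor_apply {i₁ : H₁ →ₗᵢ[ℂ] H} {i₂ : H₂ →ₗᵢ[ℂ] H}
    (hi : ∀ f g, inner ℂ (i₁ f) (i₂ g) = 0) (z : HTensor (HTensor h (Fock H₁)) (Fock H₂)) :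
    ‖factor h i₁ i₂ z‖ = ‖z‖ := by
  rw [@norm_eq_sqrt_re_inner ℂ, ← ContinuousLinearMap.adjoint_inner_right,
    ← ContinuousLinearMap.comp_apply, factor_adjoint_comp_factor hi, clm_one_apply,
    ← @norm_eq_sqrt_re_inner ℂ]

theorem norm_factor_le {i₁ : H₁ →ₗᵢ[ℂ] H} {i₂ : H₂ →ₗᵢ[ℂ] H}
    (hi : ∀ f g, inner ℂ (i₁ f) (i₂ g) = 0) : ‖factor h i₁ i₂‖ ≤ 1 :=
  ContinuousLinearMap.opNorm_le_bound _ zero_le_one fun z => by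
    rw [norm_factor_apply hi, one_mul]

theorem denseRange_factor {i₁ : H₁ →ₗᵢ[ℂ] H} {i₂ : H₂ →ₗᵢ[ℂ] H}
    (hi : ∀ f g, inner ℂ (i₁ f) (i₂ g) = 0) (hs : ∀ f, ∃ f₁ f₂, i₁ f₁ + i₂ f₂ = f) :
    DenseRange (factor h i₁ i₂) := by
  have h1 := Submodule.dense_iff_topologicalClosure_eq_top.2 (total_htmul_expVec (E := h) (H := H))
  suffices h2 : Submodule.span ℂ (range fun p : h × H =>
      (htmul p.1 (expVec p.2) : HTensor h (Fock H))) ≤ (factor h i₁ i₂).toLinearMap.range from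
    h1.mono h2
  rw [Submodule.span_le]
  rintro _ ⟨⟨u, f⟩, rfl⟩
  obtain ⟨f₁, f₂, rfl⟩ := hs f
  exact ⟨_, factor_apply _ _ hi u f₁ f₂⟩

theorem factor_comp_factor_adjoint {i₁ : H₁ →ₗᵢ[ℂ] H} {i₂ : H₂ →ₗᵢ[ℂ] H}
    (hi : ∀ f g, inner ℂ (i₁ f) (i₂ g) = 0) (hs : ∀ f, ∃ f₁ f₂, i₁ f₁ + i₂ f₂ = f) :
    factor h i₁ i₂ ∘L (factor h i₁ i₂).adjoint = 1 := by
  refine clm_ext_total total_htmul_expVec fun p => ?_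
  obtain ⟨u, f⟩ := p
  obtain ⟨f₁, f₂, rfl⟩ := hs f
  rw [ContinuousLinearMap.comp_apply, factor_adjoint_apply hi, factor_apply _ _ hi]
  rfl

end FactorUnitary

/-! ### Ampliated operators and the shifted flow on exponential vectors -/

section Cocycle

variable {k : Type u} [NormedAddCommGroup k] [InnerProductSpace ℂ k]
  {h : Type v} [NormedAddCommGroup h] [InnerProductSpace ℂ h]

theorem exists_rightShift_add_past (r : ℝ≥0) (f : L2Plus k) :
    ∃ f₁ f₂, rightShift k r f₁ + past k r f₂ = f := by
  obtain ⟨f₁, f₂, rfl⟩ := exists_past_add_future r f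
  obtain ⟨g, hg⟩ := exists_rightShift_eq r f₂
  exact ⟨g, f₁, by rw [hg, add_comm]⟩

/-- The operator `Z ⊗ I` on `h ⊗ ℱ` for `Z` on `h ⊗ ℱ_{[0,t[}`. -/
def amplPast (t : ℝ≥0) (Z : HTensor h (Fock (L2 k (Ico 0 (t : ℝ)))) →L[ℂ]
    HTensor h (Fock (L2 k (Ico 0 (t : ℝ))))) : HF k h →L[ℂ] HF k h :=
  splitAt k h t ∘L ampl (Fock (L2 k (Ici (t : ℝ)))) Z ∘L (splitAt k h t).adjoint

variable {t : ℝ≥0} (Z : HTensor h (Fock (L2 k (Ico 0 (t : ℝ)))) →L[ℂ]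
    HTensor h (Fock (L2 k (Ico 0 (t : ℝ)))))

theorem norm_amplPast_le : ‖amplPast t Z‖ ≤ ‖Z‖ := by
  have h1 : ‖splitAt k h t‖ ≤ 1 := norm_factor_le (inner_past_future t)
  have h2 : ‖(splitAt k h t).adjoint‖ ≤ 1 := by
    rwa [LinearIsometryEquiv.norm_map]
  refine ContinuousLinearMap.opNorm_le_bound _ (norm_nonneg _) fun z => ?_
  refine ((splitAt k h t).le_of_opNorm_le h1 _).trans ?_
  rw [one_mul]
  refine (ContinuousLinearMap.le_of_opNorm_le _ (norm_ampl_le Z) _).trans ?_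
  gcongr
  simpa using (splitAt k h t).adjoint.le_of_opNorm_le h2 z

theorem amplPast_one : amplPast t (1 : HTensor h (Fock (L2 k (Ico 0 (t : ℝ)))) →L[ℂ] _) = 1 := by
  rw [amplPast, ampl_one]
  exact factor_comp_factor_adjoint (inner_past_future t) (exists_past_add_future t)

theorem splitAt_adjoint_apply (u : h) (f : L2 k (Ico 0 (t : ℝ))) (g : L2 k (Ici (t : ℝ))) :
    (splitAt k h t).adjoint (htmul u (expVec (past k t f + future k t g)) : HF k h) =
      (htmul (htmul u (expVec f)) (expVec g) :
        HTensor (HTensor h (Fock (L2 k (Ico 0 (t : ℝ))))) (Fock (L2 k (Ici (t : ℝ))))) :=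
  factor_adjoint_apply (i₁ := past k t) (i₂ := future k t) (inner_past_future t) u f g

theorem shiftSplit_adjoint_apply (u : h) (f : L2Plus k) (g : L2 k (Ico 0 (t : ℝ))) :
    (shiftSplit k h t).adjoint (htmul u (expVec (rightShift k t f + past k t g)) : HF k h) =
      (htmul (htmul u (expVec f)) (expVec g) :
        HTensor (HF k h) (Fock (L2 k (Ico 0 (t : ℝ))))) :=
  factor_adjoint_apply (i₁ := rightShift k t) (i₂ := past k t) (inner_rightShift_past t) u f g

theorem inner_amplPast_eq (a b : HF k h) :
    inner ℂ a (amplPast t Z b) =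
      inner ℂ ((splitAt k h t).adjoint a)
        (ampl (Fock (L2 k (Ici (t : ℝ)))) Z ((splitAt k h t).adjoint b)) :=
  (ContinuousLinearMap.adjoint_inner_left (splitAt k h t) _ _).symm

theorem inner_amplPast (u v : h) (f g : L2 k (Ico 0 (t : ℝ))) (F G : L2 k (Ici (t : ℝ))) :
    inner ℂ (htmul u (expVec (past k t f + future k t F)))
      (amplPast t Z (htmul v (expVec (past k t g + future k t G)))) =
      inner ℂ (htmul u (expVec f)) (Z (htmul v (expVec g))) * inner ℂ (expVec F) (expVec G) := by
  refine (inner_amplPast_eq Z _ _).trans ((congrArg₂ (fun a b => inner ℂ a (ampl _ Z b))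
    (splitAt_adjoint_apply u f F) (splitAt_adjoint_apply v g G)).trans ?_)
  refine (congrArg (inner ℂ _) (ampl_htmul Z _ _)).trans ?_
  exact inner_htmul _ _ _ _

theorem inner_coherent_adjoint [CompleteSpace h] (f : L2Plus k) (u : h) (y : HF k h) :
    inner ℂ u ((coherent h f).adjoint y) = inner ℂ (htmul u (expVec f)) y :=
  ContinuousLinearMap.adjoint_inner_right _ _ _

theorem past_mem (r : ℝ≥0) (f : L2 k (Ico 0 (r : ℝ))) :
    (past k r f : Lp k 2 (volume : Measure ℝ)) ∈ L2 k (Ico 0 (r : ℝ)) := f.2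

theorem inner_shiftSplit_htmul [CompleteSpace h] (r : ℝ≥0) (F' : L2Plus k)
    (F : L2 k (Ici (r : ℝ))) (hF : future k r F = rightShift k r F')
    (f g : L2 k (Ico 0 (r : ℝ))) (u v : h) (G : L2Plus k) :
    inner ℂ (htmul u (expVec (past k r f + future k r F)) : HF k h)
      (shiftSplit k h r (htmul (htmul v (expVec G)) (expVec g))) =
      inner ℂ u v * Complex.exp (-(chi f g + chi F' G)) := by
  refine (congrArg (inner ℂ _) (shiftSplit_apply r v G g)).trans ?_
  rw [inner_htmul, inner_expVec, hF, add_comm (rightShift k r G)]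
  have h2 := chi_add_rightShift r (past_mem r f) (past_mem r g) F' G
  rw [chi_map_isometry (past k r)] at h2
  rw [h2]

theorem inner_shiftSplit [CompleteSpace h] (r : ℝ≥0) (F' : L2Plus k)
    (F : L2 k (Ici (r : ℝ))) (hF : future k r F = rightShift k r F')
    (f g : L2 k (Ico 0 (r : ℝ))) (u : h) (y : HF k h) :
    inner ℂ (htmul u (expVec (past k r f + future k r F)) : HF k h)
      (shiftSplit k h r (htmul y (expVec g))) =
      inner ℂ (htmul u (expVec f) : HTensor h (Fock (L2 k (Ico 0 (r : ℝ)))))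
        (htmul ((coherent h F').adjoint y) (expVec g)) := by
  have h1 : (innerSL ℂ (htmul u (expVec (past k r f + future k r F)) : HF k h)) ∘L
      shiftSplit k h r ∘L tensorRight (HF k h) (expVec g) =
      (innerSL ℂ (htmul u (expVec f) : HTensor h (Fock (L2 k (Ico 0 (r : ℝ)))))) ∘L
        tensorRight h (expVec g) ∘L (coherent h F').adjoint := by
    refine clm_ext_total total_htmul_expVec fun q => ?_
    have hr : inner ℂ (htmul u (expVec f) : HTensor h (Fock (L2 k (Ico 0 (r : ℝ)))))
        (htmul ((coherent h F').adjoint (htmul q.1 (expVec q.2))) (expVec g)) =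
        inner ℂ u q.1 * Complex.exp (-(chi f g + chi F' q.2)) := by
      rw [inner_htmul, inner_coherent_adjoint, inner_htmul, inner_expVec, inner_expVec,
        mul_assoc, ← Complex.exp_add, neg_add, add_comm]
    exact (inner_shiftSplit_htmul r F' F hF f g u q.1 q.2).trans hr.symm
  exact DFunLike.congr_fun h1 y

/-- Slicing the future factor by `w(F)`, where `F` is the shift of `F'`, amounts to applying
`E(F')*` to `y` before the shift. The vector `y` is general because it will be an image under `Y`,
not an exponential product vector. -/
theorem tensorRight_adjoint_splitAt_adjoint [CompleteSpace h] (r : ℝ≥0) (F' : L2Plus k)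
    (F : L2 k (Ici (r : ℝ))) (hF : future k r F = rightShift k r F')
    (g : L2 k (Ico 0 (r : ℝ))) (y : HF k h) :
    (tensorRight (HTensor h (Fock (L2 k (Ico 0 (r : ℝ))))) (expVec F)).adjoint
      ((splitAt k h r).adjoint (shiftSplit k h r (htmul y (expVec g)))) =
      htmul ((coherent h F').adjoint y) (expVec g) := by
  refine eq_of_forall_inner_total total_htmul_expVec fun q => ?_
  refine (ContinuousLinearMap.adjoint_inner_right _ _ _).trans ?_
  refine (ContinuousLinearMap.adjoint_inner_right _ _ _).trans ?_
  refine (congrArg (fun z => inner ℂ z _) (splitAt_apply r q.1 q.2 F)).trans ?_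
  exact inner_shiftSplit r F' F hF q.2 g q.1 y

theorem inner_splitAt_shiftSplit [CompleteSpace h] (r : ℝ≥0) (F' : L2Plus k)
    (F : L2 k (Ici (r : ℝ))) (hF : future k r F = rightShift k r F')
    (g : L2 k (Ico 0 (r : ℝ))) (p : HTensor h (Fock (L2 k (Ico 0 (r : ℝ))))) (y : HF k h) :
    inner ℂ (htmul p (expVec F) :
        HTensor (HTensor h (Fock (L2 k (Ico 0 (r : ℝ))))) (Fock (L2 k (Ici (r : ℝ)))))
      ((splitAt k h r).adjoint (shiftSplit k h r (htmul y (expVec g)))) =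
      inner ℂ p (htmul ((coherent h F').adjoint y) (expVec g)) := by
  refine Eq.trans ?_ (congrArg (inner ℂ p)
    (tensorRight_adjoint_splitAt_adjoint r F' F hF g y))
  exact (ContinuousLinearMap.adjoint_inner_right
    (tensorRight (HTensor h (Fock (L2 k (Ico 0 (r : ℝ))))) (expVec F)) _ _).symm

/-- The key computation for the cocycle identity: the shifted operator enters only through its
compression `E(F')* Y E(G')` to `h`, and `Z` then acts on the result in the past factor. The adjoint
of `Z` serves to move it aside while the future is sliced off. -/
theorem inner_amplPast_ccrFlow [CompleteSpace h] (Y : HF k h →L[ℂ] HF k h) (u v : h)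
    (f g : L2 k (Ico 0 (t : ℝ))) (F' G' : L2Plus k) :
    inner ℂ (htmul u (expVec (rightShift k t F' + past k t f)))
      (amplPast t Z (ccrFlow t Y (htmul v (expVec (rightShift k t G' + past k t g))))) =
      inner ℂ (htmul u (expVec f))
        (Z (htmul ((coherent h F').adjoint (Y (htmul v (expVec G')))) (expVec g))) := by
  set F : L2 k (Ici (t : ℝ)) := ⟨rightShift k t F', rightShift_mem t F'⟩ with hF
  have hFF : future k t F = rightShift k t F' := rfl
  have h1 : ccrFlow t Y (htmul v (expVec (rightShift k t G' + past k t g))) =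
      shiftSplit k h t (htmul (Y (htmul v (expVec G'))) (expVec g)) :=
    congrArg (shiftSplit k h t) ((congrArg (ampl _ Y) (shiftSplit_adjoint_apply v G' g)).trans
      (ampl_htmul Y _ _))
  have h2 : (splitAt k h t).adjoint
      (htmul u (expVec (rightShift k t F' + past k t f)) : HF k h) =
      (htmul (htmul u (expVec f)) (expVec F) :
        HTensor (HTensor h (Fock (L2 k (Ico 0 (t : ℝ))))) (Fock (L2 k (Ici (t : ℝ))))) := by
    have h3 : rightShift k t F' + past k t f = past k t f + future k t F := add_comm _ _
    exact (congrArg (fun z => (splitAt k h t).adjoint (htmul u (expVec z))) h3).trans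
      (splitAt_adjoint_apply u f F)
  refine (inner_amplPast_eq Z _ _).trans ((congrArg₂ (fun a b => inner ℂ a
    (ampl (Fock (L2 k (Ici (t : ℝ)))) Z ((splitAt k h t).adjoint b))) h2 h1).trans ?_)
  refine (inner_htmul_ampl Z _ _ _).trans ?_
  refine (inner_splitAt_shiftSplit t F' F hFF g _ _).trans ?_
  exact ContinuousLinearMap.adjoint_inner_left _ _ _

end Cocycle

/-! ### Construction of the cocycle, and the converse -/

section Construction

variable {k : Type u} [NormedAddCommGroup k] [InnerProductSpace ℂ k] [CompleteSpace k]
  {h : Type v} [NormedAddCommGroup h] [InnerProductSpace ℂ h] [CompleteSpace h]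
  {T : Set k} {S : T → T → ℝ≥0 → h →L[ℂ] h}

omit [CompleteSpace h] in
-- These vectors are adapted to both cuts: a step function on `[0, r[`, another on `[r, r + t[`, and
-- anything afterwards. They are images of products of total families under the two splitting
-- identifications, which have dense range.
theorem total_shift_step (hT0 : (0 : k) ∈ T)
    (hT : (Submodule.span ℂ T).topologicalClosure = ⊤) (r t : ℝ≥0) :
    (Submodule.span ℂ (range fun p :
      ((h × {L : List (T × ℝ≥0) // duration (listVal L) = t}) × L2 k (Ici (t : ℝ))) ×
        {L : List (T × ℝ≥0) // duration (listVal L) = r} =>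
      (htmul p.1.1.1 (expVec (rightShift k r (past k t (stepAt (listVal p.1.1.2.1) p.1.1.2.2) +
        future k t p.1.2) + past k r (stepAt (listVal p.2.1) p.2.2))) :
          HF k h))).topologicalClosure = ⊤ := by
  have h1 := dense_span_htmul (total_htmul_stepAt (h := h) hT0 hT t)
    (dense_span_expVec (H := L2 k (Ici (t : ℝ))))
  have h2 := total_image h1 (splitAt k h t)
    (denseRange_factor (inner_past_future t) (exists_past_add_future t))
  have h3 := dense_span_htmul h2 (dense_span_expVec_stepAt hT0 hT r)
  have h4 := total_image h3 (shiftSplit k h r)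
    (denseRange_factor (inner_rightShift_past r) (exists_rightShift_add_past r))
  simp only [splitAt_apply, shiftSplit_apply] at h4
  exact h4

theorem listVal_append {k : Type*} {T : Set k} (L M : List (T × ℝ≥0)) :
    listVal (L ++ M) = listVal L ++ listVal M := List.map_append

/-- The family of operators on `h ⊗ ℱ_{[0,t[}` with matrix elements given by the propagator. -/
def IsPropagatorFamily (S : T → T → ℝ≥0 → h →L[ℂ] h)
    (Z : ∀ t : ℝ≥0, HTensor h (Fock (L2 k (Ico 0 (t : ℝ)))) →L[ℂ]
      HTensor h (Fock (L2 k (Ico 0 (t : ℝ))))) : Prop :=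
  ∀ (t : ℝ≥0) (L M : List (T × ℝ≥0)) (hL : duration (listVal L) = t)
    (hM : duration (listVal M) = t) (u v : h),
    inner ℂ (htmul u (expVec (stepAt _ hL))) (Z t (htmul v (expVec (stepAt _ hM)))) =
      inner ℂ u (propagator S L M v)

variable {Z : ∀ t : ℝ≥0, HTensor h (Fock (L2 k (Ico 0 (t : ℝ)))) →L[ℂ]
      HTensor h (Fock (L2 k (Ico 0 (t : ℝ))))}

omit [CompleteSpace h] in
theorem IsPropagatorFamily.map_zero (hZ : IsPropagatorFamily S Z)
    (hS : ∀ x y, IsSemigroup (S x y)) (hT0 : (0 : k) ∈ T)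
    (hT : (Submodule.span ℂ T).topologicalClosure = ⊤) : amplPast 0 (Z 0) = 1 := by
  have h1 : Z 0 = 1 := by
    refine clm_ext_total (total_htmul_stepAt (h := h) hT0 hT 0) fun p =>
      eq_of_forall_inner_total (total_htmul_stepAt (h := h) hT0 hT 0) fun q => ?_
    rw [hZ, propagator_of_duration_eq_zero hS ((duration_listVal _).symm.trans q.2.2),
      clm_one_apply, clm_one_apply, inner_htmul, inner_expVec, chi_stepAt,
      stepFn_of_duration_eq_zero q.2.2, stepFn_of_duration_eq_zero p.2.2, chi_self]
    simp
  rw [h1, amplPast_one]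

/-- On vectors adapted to the cuts at `r` and `r + t`, both sides reduce to `⟪u, P P' v⟫` times the
inner product of the future parts, where `P` and `P'` are the propagators before and after time `r`.
The left side gets there by `propagator_append`, the right side by `inner_amplPast_ccrFlow`. -/
theorem IsPropagatorFamily.map_add (hZ : IsPropagatorFamily S Z)
    (hS : ∀ x y, IsSemigroup (S x y)) (hT0 : (0 : k) ∈ T)
    (hT : (Submodule.span ℂ T).topologicalClosure = ⊤) (r t : ℝ≥0) :
    amplPast (r + t) (Z (r + t)) = amplPast r (Z r) ∘L ccrFlow r (amplPast t (Z t)) := by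
  refine clm_ext_total (total_shift_step (h := h) hT0 hT r t) fun q =>
    eq_of_forall_inner_total (total_shift_step (h := h) hT0 hT r t) fun p => ?_
  obtain ⟨⟨⟨u, L', hL'⟩, F⟩, L, hL⟩ := p
  obtain ⟨⟨⟨v, M', hM'⟩, G⟩, M, hM⟩ := q
  dsimp only
  have hdur : ∀ {L L' : List (T × ℝ≥0)}, duration (listVal L) = r → duration (listVal L') = t →
      duration (listVal (L ++ L')) = r + t := fun h1 h2 => by
    rw [listVal_append, duration_append, h1, h2]
  have hmem : ∀ F : L2 k (Ici (t : ℝ)),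
      (rightShift k r (future k t F) : Lp k 2 (volume : Measure ℝ)) ∈
        L2 k (Ici ((r + t : ℝ≥0) : ℝ)) := fun F =>
    rightShift_mem_of_mem (fun s hs => by
      have : (t : ℝ) ≤ s - r := hs
      rw [mem_Ici, NNReal.coe_add]
      linarith) F.2
  have hfun : ∀ {L L' : List (T × ℝ≥0)} (hL : duration (listVal L) = r)
      (hL' : duration (listVal L') = t) (F : L2 k (Ici (t : ℝ))),
      rightShift k r (past k t (stepAt (listVal L') hL') + future k t F) +
        past k r (stepAt (listVal L) hL) =
      past k (r + t) (stepAt _ (hdur hL hL')) + future k (r + t) ⟨_, hmem F⟩ := by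
    intro L L' hL hL' F
    have h1 : past k (r + t) (stepAt _ (hdur hL hL')) =
        stepFn (listVal L) + rightShift k r (stepFn (listVal L')) := by
      rw [past_stepAt, listVal_append, stepFn_append, hL]
    have h2 : future k (r + t) ⟨_, hmem F⟩ = rightShift k r (future k t F) := rfl
    rw [h1, h2, _root_.map_add, past_stepAt, past_stepAt]
    abel
  have hFG : inner ℂ (expVec (⟨_, hmem F⟩ : L2 k (Ici ((r + t : ℝ≥0) : ℝ))))
      (expVec (⟨_, hmem G⟩ : L2 k (Ici ((r + t : ℝ≥0) : ℝ)))) =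
      inner ℂ (expVec F) (expVec G) := by
    rw [inner_expVec, inner_expVec, ← chi_map_isometry (future k (r + t)),
      ← chi_map_isometry (future k t) F G, ← chi_map_isometry (rightShift k r) (future k t F)]
    rfl
  -- The compression of the shifted factor to `h` is the propagator of the second interval, up to
  -- the scalar from the future.
  have hw : (coherent h (past k t (stepAt (listVal L') hL') + future k t F)).adjoint
      (amplPast t (Z t) (htmul v (expVec (past k t (stepAt (listVal M') hM') + future k t G)))) =
      inner ℂ (expVec F) (expVec G) • propagator S L' M' v := by
    refine ext_inner_left ℂ fun x => ?_
    rw [inner_coherent_adjoint, inner_amplPast, hZ, inner_smul_right, mul_comm]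
  rw [ContinuousLinearMap.comp_apply, inner_amplPast_ccrFlow, hw, hfun hL hL' F, hfun hM hM' G,
    inner_amplPast, hZ, hZ, hFG, map_smul, inner_smul_right, mul_comm,
    propagator_append hS _ L M L' M' le_rfl (by
      rw [← duration_listVal, ← duration_listVal, hL, hM]), ContinuousLinearMap.comp_apply]

omit [CompleteSpace k] in
theorem IsPropagatorFamily.assocSemigroup (hZ : IsPropagatorFamily S Z) (x y : T) :
    assocSemigroup (fun t => amplPast t (Z t)) (x : k) y = S x y := by
  funext t
  have hd : ∀ x : T, duration (listVal [(x, t)]) = t := fun x => by simp [listVal]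
  have hc : ∀ x : T, constOn (x : k) t =
      past k t (stepAt (listVal [(x, t)]) (hd x)) + future k t 0 := fun x => by
    rw [_root_.map_zero, add_zero, past_stepAt]
    exact (stepFn_singleton (x : k) t).symm
  ext v
  refine ext_inner_left ℂ fun u => ?_
  refine (inner_coherent_adjoint _ _ _).trans ?_
  change inner ℂ (htmul u (expVec (constOn (x : k) t)))
    (amplPast t (Z t) (htmul v (expVec (constOn (y : k) t)))) = _
  rw [hc, hc, inner_amplPast, hZ, inner_expVec_self, mul_one, propagator_cons_cons, if_pos le_rfl,
    propagator_nil_left]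
  rfl

theorem SchurContractive.exists_cocycle (H : SchurContractive S)
    (hS : ∀ x y, IsSemigroup (S x y)) (hT0 : (0 : k) ∈ T)
    (hT : (Submodule.span ℂ T).topologicalClosure = ⊤) :
    ∃ X : ℝ≥0 → HF k h →L[ℂ] HF k h, IsLeftContractionCocycle X ∧
      ∀ x y : T, assocSemigroup X x y = S x y := by
  choose Z hZ1 hZ using H.exists_contraction hS hT0 hT
  have hZ' : IsPropagatorFamily S Z := hZ
  exact ⟨fun t => amplPast t (Z t),
    { isProcess := fun t => ⟨Z t, rfl⟩
      map_zero := hZ'.map_zero hS hT0 hT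
      map_add := hZ'.map_add hS hT0 hT
      contraction := fun t => (norm_amplPast_le _).trans (hZ1 t) },
    hZ'.assocSemigroup⟩

theorem SchurContractive.of_contraction {X : ℝ≥0 → HF k h →L[ℂ] HF k h} (hX : ∀ t, ‖X t‖ ≤ 1)
    (hXS : ∀ x y : T, assocSemigroup X x y = S x y) : SchurContractive S := by
  intro n _ l m hl hm x t A
  rw [matNorm_sandwich_le_iff (posDef_hadamard_gram hl _ _) (posDef_hadamard_gram hm _ _) _
    (matNorm_nonneg A), gram_eq_innerMatrix]
  refine Dominated.htmul_of_contraction hl hm _ (X t) (hX t) _ (fun i j u v => ?_) A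
  rw [Matrix.of_apply, ← hXS]
  exact inner_coherent_adjoint _ _ _

end Construction

end QSCocycle

end

open QSCocycle in
theorem mainTheorem3
    {k : Type*} [NormedAddCommGroup k] [InnerProductSpace ℂ k] [CompleteSpace k]
    {h : Type*} [NormedAddCommGroup h] [InnerProductSpace ℂ h] [CompleteSpace h]
    (T : Set k) (hT : (Submodule.span ℂ T).topologicalClosure = ⊤) (hT0 : (0 : k) ∈ T)
    (S : T → T → ℝ≥0 → h →L[ℂ] h) (hS : ∀ x y, IsSemigroup (S x y)) :
    (∃ X : ℝ≥0 → HF k h →L[ℂ] HF k h, IsLeftContractionCocycle X ∧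
        ∀ x y : T, assocSemigroup X x y = S x y) ↔
      ∀ (n : ℕ), 1 ≤ n → ∀ (lam mu : Matrix (Fin n) (Fin n) ℂ), lam.PosDef → mu.PosDef →
        ∀ (x : Fin n → T) (t : ℝ≥0) (A : Matrix (Fin n) (Fin n) (Ket h)),
          matNorm (sandwich
              (CFC.sqrt (lam.hadamard (gram (fun i => (x i : k)) t)))⁻¹
              (schurAction (Matrix.of fun i j => S (x i) (x j) t)
                (sandwich (CFC.sqrt lam) A (CFC.sqrt mu)))
              (CFC.sqrt (mu.hadamard (gram (fun i => (x i : k)) t)))⁻¹) ≤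
            matNorm A :=
  ⟨fun ⟨_, hX, hXS⟩ => SchurContractive.of_contraction hX.contraction hXS,
    fun H => SchurContractive.exists_cocycle H hS hT0 hT⟩
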